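/- Let $X$ be a real Banach space admitting a $C^1$ smooth Lipschitz bump function, i.e. a $C^1$ smooth Lipschitz function $b:X\to\mathbb R$ whose support $\overline{\{b\neq 0\}}$ is bounded and non-empty. Let $M$ be a connected, paracompact Hausdorff $C^1$ Banach manifold modeled on $X$, with a Finsler structure in the sense of Palais: a continuous map $\|\cdot\|:TM\to[0,\infty)$ whose restriction $\|\cdot\|_x$ to each tangent space $T_xM$ is a norm, such that * for every $C^1$ chart $\varphi:U\to X$ and every $x\in U$, the norm $v\mapsto \|d\varphi^{-1}(\varphi(x))(v)\|_x$ is equivalent to the norm of $X$; * for every $C^1$ chart $\varphi:U\to X$, every $x_0\in U$ and every $\varepsilon>0$ there is an open neighborhood $W\subset U$ of $x_0$ such that for all $x\in W$ and $v\in X$, $$\tfrac1{1+\varepsilon}\|d\varphi^{-1}(\varphi(x_0))(v)\|_{x_0}\le \|d\varphi^{-1}(\varphi(x))(v)\|_{x}\le (1+\varepsilon)\|d\varphi^{-1}(\varphi(x_0))(v)\|_{x_0}.$$ Let $d(p,q)$ be the infimum of the lengths $\int_a^b\|c'(t)\|_{c(t)}\,dt$ of the piecewise $C^1$ paths $c:[a,b]\to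 M$ from $p$ to $q$, and assume that $M$ is complete for $d$. On the dual of $T_xM$ put $\|\Delta\|_x=\sup\{|\Delta(\xi)|:\|\xi\|_x=1\}$ (with $\sup\emptyset=0$). For $f:M\to\mathbb R$ let $D^-f(x)$ (respectively $D^+f(x)$) be the set of all $dg(x)$, where $g:M\to\mathbb R$ is $C^1$ smooth and $f-g$ attains a local minimum (respectively local maximum) at $x$. Let $H:M\times\mathbb R\to\mathbb R$ be continuous and consider $$u(x)+H(x,\|du(x)\|_x)=0.\qquad (E)$$ A function $u:M\to\mathbb R$ is a viscosity subsolution of (E) if it is upper semicontinuous and $u(x)+H(x,\|\Delta\|_x)\le 0$ for all $x\in M$ and $\Delta\in D^+u(x)$; a function $v:M\to\mathbb R$ is a viscosity supersolution of (E) if it is lower semicontinuous and $v(x)+H(x,\|\Delta\|_x)\ge 0$ for all $x\in M$ and $\Delta\in D^-v(x)$. Assume that $H$ satisfies condition (A): there are a constant $C\ge 0$ and a continuous function $\omega:\mathbb R\times\mathbb R\to\mathbb R$ with $\omega(0,0)=0$ such that for all $x_1,x_2\in M$ and $t_1,t_2\in\mathbb R$, $$|H(x_1,t_1)-H(x_2,t_2)|\le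 \omega\big(d(x_1,x_2),t_1-t_2\big)+C\max\{|t_1|,|t_2|\}\,d(x_1,x_2).$$ If $u$ is a bounded viscosity subsolution of (E), $v$ is a bounded viscosity supersolution of (E), and for every $x\in M$ at least one of $u$, $v$ is Lipschitz with respect to $d$ in a neighborhood of $x$, then $$\inf_M (v-u)\ge 0.$$ -/

import Mathlib

open Set Filter Topology MeasureTheory
open scoped Manifold ENNReal

noncomputable section

namespace FinslerHJ

/-- A Banach space `X` admits a `C¹` smooth Lipschitz bump function: a real function on `X` whose
support (the closure of its non-vanishing set) is bounded and non-empty. -/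
def HasLipschitzBump (X : Type*) [NormedAddCommGroup X] [NormedSpace ℝ X] : Prop :=
  ∃ b : X → ℝ, ContDiff ℝ 1 b ∧ (∃ K, LipschitzWith K b) ∧
    Bornology.IsBounded (tsupport b) ∧ (tsupport b).Nonempty

section Manifold

variable {X : Type*} [NormedAddCommGroup X] [NormedSpace ℝ X]
  {M : Type*} [TopologicalSpace M] [ChartedSpace X M]

/-- For a chart `φ`, a point `x` of its domain and `v ∈ X`, the number
`‖dφ⁻¹(φ(x))(v)‖ₓ` (note that `φ.symm (φ x) = x` on the domain of `φ`). -/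
def chartNorm (N : ∀ x : M, Seminorm ℝ (TangentSpace 𝓘(ℝ, X) x))
    (φ : OpenPartialHomeomorph M X) (x : M) (v : X) : ℝ :=
  N (φ.symm (φ x)) (mfderiv 𝓘(ℝ, X) 𝓘(ℝ, X) φ.symm (φ x) v)

variable (X M) in
/-- A Finsler structure in the sense of Palais on a `C¹` Banach manifold `M` modeled on `X`. -/
structure FinslerStructure [IsManifold 𝓘(ℝ, X) 1 M] where
  /-- The function `‖·‖ₓ` on each tangent space. -/
  normAt : ∀ x : M, Seminorm ℝ (TangentSpace 𝓘(ℝ, X) x)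
  /-- Each `‖·‖ₓ` is a norm. -/
  eq_zero : ∀ (x : M) (v : TangentSpace 𝓘(ℝ, X) x), normAt x v = 0 → v = 0
  /-- The map `‖·‖ : TM → [0, ∞)` is continuous. -/
  continuous_norm : Continuous fun p : TangentBundle 𝓘(ℝ, X) M => normAt p.proj p.snd
  /-- (P1): read in any `C¹` chart around `x`, `‖·‖ₓ` is equivalent to the norm of `X`. -/
  equivalent : ∀ φ ∈ IsManifold.maximalAtlas 𝓘(ℝ, X) 1 M, ∀ x ∈ φ.source,
    ∃ K : ℝ, 1 ≤ K ∧ ∀ v : X,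
      K⁻¹ * ‖v‖ ≤ chartNorm normAt φ x v ∧ chartNorm normAt φ x v ≤ K * ‖v‖
  /-- (P2): read in any `C¹` chart around `x₀`, the norms `‖·‖ₓ` and `‖·‖_{x₀}` are
  `(1 + ε)`-equivalent for `x` near `x₀`. -/
  palais : ∀ φ ∈ IsManifold.maximalAtlas 𝓘(ℝ, X) 1 M, ∀ x₀ ∈ φ.source, ∀ ε : ℝ, 0 < ε →
    ∃ W : Set M, IsOpen W ∧ x₀ ∈ W ∧ W ⊆ φ.source ∧ ∀ x ∈ W, ∀ v : X,
      (1 + ε)⁻¹ * chartNorm normAt φ x₀ v ≤ chartNorm normAt φ x v ∧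
        chartNorm normAt φ x v ≤ (1 + ε) * chartNorm normAt φ x₀ v

variable (X) in
/-- `c` restricted to `[a, b]` is a piecewise `C¹` smooth path: there is a partition
`a = t 0 ≤ t 1 ≤ ⋯ ≤ t n = b` such that `c` is `C¹` on each `[t i, t (i + 1)]`. -/
def IsPiecewiseC1 (c : ℝ → M) (a b : ℝ) : Prop :=
  ∃ (n : ℕ) (t : ℕ → ℝ), Monotone t ∧ t 0 = a ∧ t n = b ∧
    ∀ i < n, ContMDiffOn 𝓘(ℝ, ℝ) 𝓘(ℝ, X) 1 c (Icc (t i) (t (i + 1)))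

variable (X) in
/-- The set of superdifferentials of `f` at `x`: the differentials `dg(x)` of the `C¹` smooth
functions `g : M → ℝ` such that `f - g` has a local maximum at `x`. -/
def superdifferential (f : M → ℝ) (x : M) : Set (TangentSpace 𝓘(ℝ, X) x →L[ℝ] ℝ) :=
  {Δ | ∃ g : M → ℝ, ContMDiff 𝓘(ℝ, X) 𝓘(ℝ, ℝ) 1 g ∧
    IsLocalMax (fun y => f y - g y) x ∧ mvfderiv 𝓘(ℝ, X) g x = Δ}

variable (X) in
/-- The set of subdifferentials of `f` at `x`: the differentials `dg(x)` of the `C¹` smooth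
functions `g : M → ℝ` such that `f - g` has a local minimum at `x`. -/
def subdifferential (f : M → ℝ) (x : M) : Set (TangentSpace 𝓘(ℝ, X) x →L[ℝ] ℝ) :=
  {Δ | ∃ g : M → ℝ, ContMDiff 𝓘(ℝ, X) 𝓘(ℝ, ℝ) 1 g ∧
    IsLocalMin (fun y => f y - g y) x ∧ mvfderiv 𝓘(ℝ, X) g x = Δ}

namespace FinslerStructure

variable [IsManifold 𝓘(ℝ, X) 1 M] (F : FinslerStructure X M)

/-- The length `∫ₐᵇ ‖c'(t)‖_{c(t)} dt` of a (piecewise `C¹`) path. -/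
def pathLength (c : ℝ → M) (a b : ℝ) : ℝ≥0∞ :=
  ∫⁻ t in Icc a b,
    ENNReal.ofReal (F.normAt (c t) (mfderiv 𝓘(ℝ, ℝ) 𝓘(ℝ, X) c t (1 : ℝ)))

/-- The infimum, in `[0, ∞]`, of the lengths of the piecewise `C¹` paths from `p` to `q`. -/
def edist (p q : M) : ℝ≥0∞ :=
  sInf {ℓ | ∃ (c : ℝ → M) (a b : ℝ), a ≤ b ∧ IsPiecewiseC1 X c a b ∧ c a = p ∧ c b = q ∧
    ℓ = F.pathLength c a b}

/-- The Finsler metric `d`; on a connected manifold the infimum is finite. -/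
def dist (p q : M) : ℝ := (F.edist p q).toReal

/-- `M` is complete for the Finsler metric: every Cauchy sequence for `d` converges for `d`. -/
def IsComplete : Prop :=
  ∀ s : ℕ → M, (∀ ε : ℝ, 0 < ε → ∃ k, ∀ m ≥ k, ∀ n ≥ k, F.dist (s m) (s n) < ε) →
    ∃ x, Tendsto (fun n => F.dist (s n) x) atTop (𝓝 0)

/-- `u` is Lipschitz, for the Finsler metric, in a neighborhood of `x`. -/
def IsLipschitzNear (u : M → ℝ) (x : M) : Prop :=
  ∃ A ∈ 𝓝 x, ∃ K : ℝ, 0 ≤ K ∧ ∀ y ∈ A, ∀ z ∈ A, |u y - u z| ≤ K * F.dist y z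

/-- The dual norm `‖Δ‖ₓ = sup {|Δ(ξ)| : ‖ξ‖ₓ = 1}` on the dual of `TₓM`. -/
def dualNorm (x : M) (Δ : TangentSpace 𝓘(ℝ, X) x →L[ℝ] ℝ) : ℝ :=
  sSup {r | ∃ ξ : TangentSpace 𝓘(ℝ, X) x, F.normAt x ξ = 1 ∧ r = |Δ ξ|}

/-- `u` is a viscosity subsolution of `u(x) + H(x, ‖du(x)‖ₓ) = 0`. -/
def IsViscositySubsolution (H : M → ℝ → ℝ) (u : M → ℝ) : Prop :=
  UpperSemicontinuous u ∧
    ∀ x, ∀ Δ ∈ superdifferential X u x, u x + H x (F.dualNorm x Δ) ≤ 0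

/-- `v` is a viscosity supersolution of `v(x) + H(x, ‖dv(x)‖ₓ) = 0`. -/
def IsViscositySupersolution (H : M → ℝ → ℝ) (v : M → ℝ) : Prop :=
  LowerSemicontinuous v ∧
    ∀ x, ∀ Δ ∈ subdifferential X v x, 0 ≤ v x + H x (F.dualNorm x Δ)

/-- Condition (A) on the Hamiltonian `H`. -/
def ConditionA (H : M → ℝ → ℝ) : Prop :=
  ∃ (C : ℝ) (ω : ℝ × ℝ → ℝ), 0 ≤ C ∧ Continuous ω ∧ ω (0, 0) = 0 ∧
    ∀ (x₁ x₂ : M) (t₁ t₂ : ℝ),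
      |H x₁ t₁ - H x₂ t₂| ≤
        ω (F.dist x₁ x₂, t₁ - t₂) + C * max |t₁| |t₂| * F.dist x₁ x₂

end FinslerStructure

end Manifold

end FinslerHJ

end

/-! Argue by contradiction: let `m = inf (v - u) < 0`. At a common point of differentiability
minimizing `v - u` the two differentials would agree, and the two viscosity inequalities would
clash. Neither minimum nor differentiability is available, so both are replaced by approximations.

Ekeland's principle for the complete metric `d` (`exists_ekeland`) gives an almost minimizing `x₀`
at which `v - u + ε d(x₀, ·)` has a minimum. In a chart around `x₀`, Palais' condition makes all
nearby norms almost equal to a single norm `p`, and straight segments give `d ≤ (1 + κ) p`. Hence `v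
- u + 2ε p(· - x₀)` has a local minimum at `x₀` in the chart.

The fuzzy sum rule (`IsUnitBump.fuzzy_sum_rule`) then separates `v` from `-u`: it finds points `x₁`,
`x₂` near `x₀` and `C¹` test functions touching `v` at `x₁` and `-u` at `x₂` whose derivatives
cancel up to `O(ε)`. It rests on a smooth variational principle (`IsUnitBump.exists_perturbed_min`),
where the Lipschitz bump enters. Cut-offs extend the test functions to `M`, and
`exists_close_differentials` converts the outcome to dual norms.

The local Lipschitz hypothesis bounds both dual norms by a `T` fixed before the closeness `r` of
`x₁` and `x₂`. So the term `C max(|t₁|, |t₂|) d(x₁, x₂)` of condition (A) is at most `C T r`, which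
can be made small, and subtracting the two viscosity inequalities contradicts `m < 0`. -/

namespace FinslerHJ

/-! ### Normalized bump functions -/

/-- A normalized `C¹` Lipschitz bump function: values in `[0, 1]`, equal to `1` near the origin and
vanishing outside the open unit ball. -/
structure IsUnitBump {E : Type*} [NormedAddCommGroup E] [NormedSpace ℝ E] (b : E → ℝ)
    (K : NNReal) : Prop where
  contDiff : ContDiff ℝ 1 b
  lipschitz : LipschitzWith K b
  nonneg : ∀ x, 0 ≤ b x
  le_one : ∀ x, b x ≤ 1
  eventually_eq_one : ∀ᶠ x in 𝓝 0, b x = 1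
  eq_zero : ∀ x, 1 ≤ ‖x‖ → b x = 0

theorem IsUnitBump.apply_zero {E : Type*} [NormedAddCommGroup E] [NormedSpace ℝ E] {b : E → ℝ}
    {K : NNReal} (hb : IsUnitBump b K) : b 0 = 1 :=
  hb.eventually_eq_one.self_of_nhds

/-- The function is constant on either side of `[0, 1]`, so it factors through the projection onto
this compact interval, where being `C¹` suffices. -/
theorem exists_lipschitzWith_smoothTransition :
    ∃ K, LipschitzWith K Real.smoothTransition := by
  obtain ⟨K, hK⟩ := (Real.smoothTransition.contDiff (n := 1)).contDiffOn.exists_lipschitzOnWith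
    one_ne_zero (convex_Icc (0 : ℝ) 1) isCompact_Icc
  refine ⟨K, LipschitzWith.of_dist_le_mul fun x y => ?_⟩
  rw [← Real.smoothTransition.projIcc (x := x), ← Real.smoothTransition.projIcc (x := y)]
  refine (hK.dist_le_mul _ (projIcc (0 : ℝ) 1 zero_le_one x).2 _
    (projIcc (0 : ℝ) 1 zero_le_one y).2).trans ?_
  gcongr
  have := (LipschitzWith.projIcc (zero_le_one (α := ℝ))).dist_le_mul x y
  simpa [Subtype.dist_eq] using this

theorem HasLipschitzBump.exists_isUnitBump {X : Type*} [NormedAddCommGroup X] [NormedSpace ℝ X]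
    (hX : HasLipschitzBump X) : ∃ (b : X → ℝ) (K : NNReal), IsUnitBump b K := by
  obtain ⟨b₀, hb, ⟨K₀, hK₀⟩, hbdd, hne⟩ := hX
  obtain ⟨K₁, hK₁⟩ := exists_lipschitzWith_smoothTransition
  obtain ⟨a, ha⟩ : (Function.support b₀).Nonempty := by
    rwa [tsupport, closure_nonempty_iff] at hne
  obtain ⟨R₀, hR₀⟩ := hbdd.exists_norm_le
  have hR₀a : ‖a‖ ≤ R₀ := hR₀ a (subset_tsupport _ ha)
  -- Recentre at a point `a` with `b₀ a ≠ 0` and dilate by `R`: if `‖x‖ ≥ 1` then `‖a + R • x‖ ≥ R -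
  -- ‖a‖ > R₀`, outside the support. The factor `2 / b₀ a` gives value `2 > 1` at the centre, so the
  -- smooth transition is `1` on a whole neighborhood.
  set R : ℝ := R₀ + ‖a‖ + 1 with hR
  have hRpos : 0 < R := by have := norm_nonneg a; linarith
  have hac : b₀ a ≠ 0 := ha
  have lip : LipschitzWith (K₁ * (‖2 / b₀ a‖₊ * (K₀ * ‖R‖₊)))
      (fun x : X => Real.smoothTransition (2 / b₀ a * b₀ (a + R • x))) := by
    refine hK₁.comp ?_
    have h1 : LipschitzWith ‖R‖₊ (fun x : X => a + R • x) :=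
      LipschitzWith.of_dist_le_mul fun x y => by
        rw [dist_add_left, dist_smul₀]; simp
    have h2 : LipschitzWith ‖2 / b₀ a‖₊ (fun s : ℝ => 2 / b₀ a * s) := lipschitzWith_smul _
    exact h2.comp (hK₀.comp h1)
  refine ⟨_, _, ⟨?_, lip, fun x => Real.smoothTransition.nonneg _,
    fun x => Real.smoothTransition.le_one _, ?_, ?_⟩⟩
  · exact Real.smoothTransition.contDiff.comp (by fun_prop)
  · have hc : ContinuousAt (fun x : X => 2 / b₀ a * b₀ (a + R • x)) 0 :=
      (by have := hb.continuous; fun_prop : Continuous _).continuousAt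
    have h1 : (1 : ℝ) < 2 / b₀ a * b₀ (a + R • (0 : X)) := by
      rw [smul_zero, add_zero, div_mul_cancel₀ _ hac]; norm_num
    filter_upwards [hc.eventually (lt_mem_nhds h1)] with x hx
    exact Real.smoothTransition.one_of_one_le hx.le
  · intro x hx
    have : b₀ (a + R • x) = 0 := by
      by_contra h
      have h1 := hR₀ _ (subset_tsupport _ h)
      have h2 : ‖R • x‖ ≤ ‖a + R • x‖ + ‖a‖ := by
        simpa using norm_sub_le (a + R • x) a
      rw [norm_smul, Real.norm_of_nonneg hRpos.le] at h2
      nlinarith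
    simp [this, Real.smoothTransition.zero_of_nonpos]

/-! ### Smooth variational principle -/

section VariationalPrinciple

variable {E : Type*} [NormedAddCommGroup E] [NormedSpace ℝ E]

theorem IsUnitBump.contDiff_rescale {b : E → ℝ} {K : NNReal} (hb : IsUnitBump b K) (c r : ℝ)
    (w : E) : ContDiff ℝ 1 fun x => c * b (r • (x - w)) := by
  have := hb.contDiff
  fun_prop

theorem IsUnitBump.norm_fderiv_rescale_le {b : E → ℝ} {K : NNReal} (hb : IsUnitBump b K) {c r : ℝ}
    (hc : 0 ≤ c) (hr : 0 ≤ r) (w x : E) :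
    ‖fderiv ℝ (fun x => c * b (r • (x - w))) x‖ ≤ c * K * r := by
  have h : LipschitzWith (‖c‖₊ * (K * ‖r‖₊)) (fun x => c * b (r • (x - w))) := by
    have h1 : LipschitzWith ‖r‖₊ (fun x : E => r • (x - w)) :=
      LipschitzWith.of_dist_le_mul fun x y => by
        rw [dist_smul₀, dist_sub_right]; simp
    have h2 : LipschitzWith ‖c‖₊ (fun s : ℝ => c * s) := lipschitzWith_smul _
    exact h2.comp (hb.lipschitz.comp h1)
  refine (norm_fderiv_le_of_lipschitz ℝ h).trans_eq ?_
  simp [abs_of_nonneg hc, abs_of_nonneg hr, mul_assoc]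

/-- A function bounded below on a nonempty set has approximate minimizers. -/
theorem exists_approx_min {α : Type*} {S : Set α} (hS : S.Nonempty) {G : α → ℝ}
    (hG : ∃ B, ∀ x ∈ S, B ≤ G x) {δ : ℝ} (hδ : 0 < δ) : ∃ w ∈ S, ∀ x ∈ S, G w ≤ G x + δ := by
  obtain ⟨B, hB⟩ := hG
  have hbdd : BddBelow (G '' S) := ⟨B, by rintro _ ⟨x, hx, rfl⟩; exact hB x hx⟩
  obtain ⟨_, ⟨w, hw, rfl⟩, h⟩ :=
    exists_lt_of_csInf_lt (hS.image G) (lt_add_of_pos_right (sInf (G '' S)) hδ)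
  exact ⟨w, hw, fun x hx => h.le.trans (by gcongr; exact csInf_le hbdd ⟨x, hx, rfl⟩)⟩

/-- The successive perturbed functions in the smooth variational principle. -/
noncomputable def perturb (b : E → ℝ) (δ : ℝ) (pick : ℕ → (E → ℝ) → E) (Φ : E → ℝ) : ℕ → E → ℝ
  | 0 => Φ
  | n + 1 => fun x => perturb b δ pick Φ n x -
      2 * (δ * (1 / 4) ^ n) * b ((2 : ℝ) ^ n • (x - pick n (perturb b δ pick Φ n)))

theorem perturb_eq_sub_sum (b : E → ℝ) (δ : ℝ) (pick : ℕ → (E → ℝ) → E) (Φ : E → ℝ) (n : ℕ)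
    (x : E) : perturb b δ pick Φ n x = Φ x - ∑ k ∈ Finset.range n,
      2 * (δ * (1 / 4) ^ k) * b ((2 : ℝ) ^ k • (x - pick k (perturb b δ pick Φ k))) := by
  induction n with
  | zero => simp [perturb]
  | succ n ih => rw [Finset.sum_range_succ, perturb]; dsimp only; rw [ih]; ring

/-- Smooth variational principle. -/
theorem IsUnitBump.exists_perturbed_min [CompleteSpace E] {b : E → ℝ} {K : NNReal}
    (hb : IsUnitBump b K) {S : Set E} (hS : IsClosed S) (hne : S.Nonempty) {Φ : E → ℝ}
    (hΦ : LowerSemicontinuousOn Φ S) (hbd : ∃ B, ∀ x ∈ S, B ≤ Φ x) {η : ℝ} (hη : 0 < η) :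
    ∃ φ : E → ℝ, ContDiff ℝ 1 φ ∧ (∀ x, 0 ≤ φ x) ∧ (∀ x, φ x ≤ η) ∧
      (∀ x, ‖fderiv ℝ φ x‖ ≤ η) ∧ ∃ w ∈ S, ∀ x ∈ S, Φ w - φ w ≤ Φ x - φ x := by
  -- The bumps have heights `2δ4⁻ⁿ` and gradients at most `2δK2⁻ⁿ`; the sums `8δ/3` and `4δK` must
  -- both stay below `η`.
  set δ : ℝ := η / (4 * (K + 1)) with hδdef
  have hK0 : (0 : ℝ) ≤ K := K.2
  have hδ : 0 < δ := by positivity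
  have hδη : δ * (4 * (K + 1)) = η := by rw [hδdef]; field_simp
  have hpos : ∀ n : ℕ, 0 < δ * (1 / 4 : ℝ) ^ n := fun n => by positivity
  -- The choice is made for every `G`, so that the recursion is defined before its functions are
  -- known to be bounded below; `0` is a junk value.
  have hpick : ∀ (n : ℕ) (G : E → ℝ), ∃ w, (∃ B, ∀ x ∈ S, B ≤ G x) →
      w ∈ S ∧ ∀ x ∈ S, G w ≤ G x + δ * (1 / 4) ^ n := by
    intro n G
    by_cases h : ∃ B, ∀ x ∈ S, B ≤ G x
    · obtain ⟨w, hw, h'⟩ := exists_approx_min hne h (hpos n)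
      exact ⟨w, fun _ => ⟨hw, h'⟩⟩
    · exact ⟨0, fun h' => absurd h' h⟩
  choose pick hpick using hpick
  set G : ℕ → E → ℝ := perturb b δ pick Φ with hG
  set w : ℕ → E := fun n => pick n (G n) with hw
  set t : ℕ → E → ℝ := fun n x => 2 * (δ * (1 / 4) ^ n) * b ((2 : ℝ) ^ n • (x - w n)) with ht
  have hG_eq : ∀ n x, G n x = Φ x - ∑ k ∈ Finset.range n, t k x :=
    fun n x => perturb_eq_sub_sum b δ pick Φ n x
  have hG_succ : ∀ n x, G (n + 1) x = G n x - t n x := fun n x => rfl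
  have t_nonneg : ∀ n x, 0 ≤ t n x := fun n x =>
    mul_nonneg (by have := hpos n; positivity) (hb.nonneg _)
  have t_le : ∀ n x, t n x ≤ 2 * (δ * (1 / 4) ^ n) := fun n x =>
    mul_le_of_le_one_right (by have := hpos n; positivity) (hb.le_one _)
  have hGbdd : ∀ n, ∃ B, ∀ x ∈ S, B ≤ G n x := by
    intro n
    induction n with
    | zero => exact hbd
    | succ n ih =>
      obtain ⟨B, hB⟩ := ih
      exact ⟨B - 2 * (δ * (1 / 4) ^ n), fun x hx => by
        rw [hG_succ]; linarith [hB x hx, t_le n x]⟩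
  have hwS : ∀ n, w n ∈ S := fun n => (hpick n (G n) (hGbdd n)).1
  have hwmin : ∀ n, ∀ x ∈ S, G n (w n) ≤ G n x + δ * (1 / 4) ^ n :=
    fun n => (hpick n (G n) (hGbdd n)).2
  -- Subtracting the `n`-th bump lowers the value at `w n` by `2δ4⁻ⁿ` and changes nothing at
  -- distance at least `2⁻ⁿ`. A point that far away gains at most `δ4⁻ⁿ` on `w n` for `G n`, so it
  -- cannot be a `δ4⁻ⁿ⁻¹`-minimizer of `G (n + 1)`.
  have hstep : ∀ n, dist (w n) (w (n + 1)) ≤ 1 * (1 / 2 : ℝ) ^ n := by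
    intro n
    by_contra! hlt
    have hz : t n (w (n + 1)) = 0 := by
      have : 1 ≤ ‖(2 : ℝ) ^ n • (w (n + 1) - w n)‖ := by
        rw [norm_smul, ← dist_eq_norm, dist_comm, norm_pow, Real.norm_ofNat]
        have h2 : (2 : ℝ) ^ n * (1 * (1 / 2) ^ n) = 1 := by
          rw [one_mul, ← mul_pow]; norm_num
        rw [← h2]; gcongr
      simp [ht, hb.eq_zero _ this]
    have hone : t n (w n) = 2 * (δ * (1 / 4) ^ n) := by simp [ht, hb.apply_zero]
    have h1 := hwmin n _ (hwS (n + 1))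
    have h2 := hwmin (n + 1) _ (hwS n)
    rw [hG_succ, hG_succ, hz, hone, pow_succ] at h2
    have := hpos n
    linarith
  obtain ⟨a, ha⟩ := cauchySeq_tendsto_of_complete
    (cauchySeq_of_le_geometric (1 / 2 : ℝ) 1 (by norm_num) hstep)
  have haS : a ∈ S := hS.mem_of_tendsto ha (Eventually.of_forall hwS)
  have hs4 : HasSum (fun n : ℕ => 2 * (δ * (1 / 4 : ℝ) ^ n)) (2 * (δ * (4 / 3))) := by
    have := hasSum_geometric_of_lt_one (r := (1 / 4 : ℝ)) (by norm_num) (by norm_num)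
    rw [show (1 - 1 / 4 : ℝ)⁻¹ = 4 / 3 by norm_num] at this
    exact (this.mul_left δ).mul_left 2
  have hs2 : HasSum (fun n : ℕ => 2 * (δ * (1 / 4 : ℝ) ^ n) * K * 2 ^ n) (4 * δ * K) := by
    have := (hasSum_geometric_of_lt_one (r := (1 / 2 : ℝ)) (by norm_num) (by norm_num)).mul_left
      (2 * δ * K)
    rw [show 2 * δ * K * (1 - 1 / 2 : ℝ)⁻¹ = 4 * δ * K by norm_num; ring] at this
    refine this.congr_fun fun n => ?_
    rw [show (1 / 2 : ℝ) ^ n = (1 / 4) ^ n * 2 ^ n by rw [← mul_pow]; norm_num]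
    ring
  have hnorm : ∀ n x, ‖t n x‖ ≤ 2 * (δ * (1 / 4) ^ n) := fun n x => by
    rw [Real.norm_of_nonneg (t_nonneg n x)]; exact t_le n x
  have hsum : ∀ x, Summable fun n => t n x := fun x =>
    Summable.of_norm_bounded hs4.summable fun n => hnorm n x
  have hcd : ∀ n, ContDiff ℝ 1 (t n) := fun n => hb.contDiff_rescale _ _ _
  have hfd : ∀ n x, ‖fderiv ℝ (t n) x‖ ≤ 2 * (δ * (1 / 4 : ℝ) ^ n) * K * 2 ^ n := fun n x =>
    hb.norm_fderiv_rescale_le (by have := hpos n; positivity) (by positivity) _ _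
  set φ : E → ℝ := fun x => ∑' n, t n x with hφ
  have hφc : ContDiff ℝ 1 φ := by
    refine contDiff_tsum (N := 1)
      (v := fun k n => if k = 0 then 2 * (δ * (1 / 4 : ℝ) ^ n)
        else 2 * (δ * (1 / 4 : ℝ) ^ n) * K * 2 ^ n) hcd ?_ ?_
    · intro k _
      by_cases hk : k = 0
      · simpa [hk] using hs4.summable
      · simpa [hk] using hs2.summable
    · intro k n x hk
      have hk' : k ≤ 1 := by exact_mod_cast hk
      interval_cases k
      · simpa using hnorm n x
      · rw [norm_iteratedFDeriv_one]; simpa using hfd n x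
  have hfdφ : ∀ x, ‖fderiv ℝ φ x‖ ≤ 4 * δ * K := by
    intro x
    rw [hφ, fderiv_tsum hs2.summable (fun n => (hcd n).differentiable one_ne_zero) hfd (hsum 0)]
    exact tsum_of_norm_bounded hs2 fun n => hfd n x
  have hsumφ : ∀ x, Tendsto (fun n => ∑ k ∈ Finset.range n, t k x) atTop (𝓝 (φ x)) := fun x =>
    (hsum x).hasSum.tendsto_sum_nat
  refine ⟨φ, hφc, fun x => tsum_nonneg fun n => t_nonneg n x, fun x => ?_, fun x => ?_, a, haS,
    fun x hx => ?_⟩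
  · refine ((hsum x).tsum_le_tsum (fun n => t_le n x) hs4.summable).trans ?_
    rw [hs4.tsum_eq]; nlinarith
  · refine (hfdφ x).trans ?_
    nlinarith
  -- Pass to the limit in `Φ (w n) - φ (w n) ≤ G n (w n) ≤ G n x + δ4⁻ⁿ`, the first inequality
  -- because the omitted bumps are nonnegative.
  · refine le_of_forall_pos_le_add fun ε hε => ?_
    have hlsc : ∀ᶠ n in atTop, Φ a - ε < Φ (w n) :=
      (tendsto_nhdsWithin_iff.2 ⟨ha, Eventually.of_forall hwS⟩).eventually
        (hΦ a haS (Φ a - ε) (by linarith))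
    have h0 : Tendsto (fun n : ℕ => δ * (1 / 4 : ℝ) ^ n) atTop (𝓝 0) := by
      simpa using (tendsto_pow_atTop_nhds_zero_of_lt_one (r := (1 / 4 : ℝ)) (by norm_num)
        (by norm_num)).const_mul δ
    have hL : Tendsto (fun n => Φ a - ε - φ (w n)) atTop (𝓝 (Φ a - ε - φ a)) :=
      tendsto_const_nhds.sub ((hφc.continuous.tendsto a).comp ha)
    have hR : Tendsto (fun n => (Φ x - ∑ k ∈ Finset.range n, t k x) + δ * (1 / 4 : ℝ) ^ n)
        atTop (𝓝 (Φ x - φ x + 0)) := ((tendsto_const_nhds.sub (hsumφ x)).add h0)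
    have := le_of_tendsto_of_tendsto hL hR (hlsc.mono fun n hn => by
      have h1 := hwmin n x hx
      rw [hG_eq, hG_eq] at h1
      have h2 : ∑ k ∈ Finset.range n, t k (w n) ≤ φ (w n) :=
        (hsum (w n)).sum_le_tsum _ fun k _ => t_nonneg k _
      linarith)
    linarith

end VariationalPrinciple

/-! ### Fuzzy sum rule -/

section FuzzySum

/-- Supplies bumps on `X × X × X`. For the sup norm, being outside the unit ball means that one
coordinate is, and its factor vanishes. -/
theorem IsUnitBump.prod {E E' : Type*} [NormedAddCommGroup E] [NormedSpace ℝ E]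
    [NormedAddCommGroup E'] [NormedSpace ℝ E'] {b : E → ℝ} {b' : E' → ℝ} {K K' : NNReal}
    (hb : IsUnitBump b K) (hb' : IsUnitBump b' K') :
    IsUnitBump (fun w : E × E' => b w.1 * b' w.2) (K + K') := by
  refine ⟨?_, LipschitzWith.of_dist_le_mul fun x y => ?_,
    fun x => mul_nonneg (hb.nonneg _) (hb'.nonneg _),
    fun x => mul_le_one₀ (hb.le_one _) (hb'.nonneg _) (hb'.le_one _), ?_, fun x hx => ?_⟩
  · have h1 := hb.contDiff
    have h2 := hb'.contDiff
    fun_prop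
  · have h1 := hb.lipschitz.dist_le_mul x.1 y.1
    have h2 := hb'.lipschitz.dist_le_mul x.2 y.2
    have h3 : dist x.1 y.1 ≤ dist x y := le_max_left _ _
    have h4 : dist x.2 y.2 ≤ dist x y := le_max_right _ _
    rw [Real.dist_eq] at h1 h2 ⊢
    have h5 : b x.1 * b' x.2 - b y.1 * b' y.2 =
        (b x.1 - b y.1) * b' x.2 + b y.1 * (b' x.2 - b' y.2) := by ring
    rw [h5, NNReal.coe_add, add_mul]
    refine (abs_add_le _ _).trans (add_le_add ?_ ?_)
    · rw [abs_mul, abs_of_nonneg (hb'.nonneg _)]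
      exact (mul_le_of_le_one_right (abs_nonneg _) (hb'.le_one _)).trans (h1.trans (by gcongr))
    · rw [abs_mul, abs_of_nonneg (hb.nonneg _)]
      exact (mul_le_of_le_one_left (abs_nonneg _) (hb.le_one _)).trans (h2.trans (by gcongr))
  · rw [← Prod.mk_zero_zero, nhds_prod_eq]
    filter_upwards [hb.eventually_eq_one.prod_mk hb'.eventually_eq_one] with x hx
    rw [hx.1, hx.2, one_mul]
  · rcases le_max_iff.1 (Prod.norm_def x ▸ hx) with h | h
    · rw [hb.eq_zero _ h, zero_mul]
    · rw [hb'.eq_zero _ h, mul_zero]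

theorem _root_.LowerSemicontinuousOn.comp_of_mapsTo {α β : Type*} [TopologicalSpace α]
    [TopologicalSpace β] {f : β → ℝ} {T : Set β} (hf : LowerSemicontinuousOn f T) {φ : α → β}
    {S : Set α} (hφ : ContinuousOn φ S) (h : MapsTo φ S T) :
    LowerSemicontinuousOn (fun x => f (φ x)) S := fun x hx y hy =>
  ((hφ x hx).tendsto_nhdsWithin h).eventually (hf (φ x) (h hx) y hy)

variable {X : Type*} [NormedAddCommGroup X] [NormedSpace ℝ X]

/-- A test function touching from below a function that is `L`-Lipschitz for a seminorm has its
derivative bounded by `L`. -/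
theorem abs_fderiv_le_of_isLocalMin_sub {p : Seminorm ℝ X} {h G : X → ℝ} {z : X} {L : ℝ}
    (hG : DifferentiableAt ℝ G z) (hmin : IsLocalMin (fun y => h y - G y) z)
    (hL : ∀ᶠ y in 𝓝 z, |h y - h z| ≤ L * p (y - z)) (v : X) :
    |fderiv ℝ G z v| ≤ L * p v := by
  have key : ∀ v, fderiv ℝ G z v ≤ L * p v := by
    intro v
    have hline : HasDerivAt (fun t : ℝ => G (z + t • v)) (fderiv ℝ G z v) 0 :=
      hG.hasFDerivAt.hasLineDerivAt v
    have ht : Tendsto (fun t : ℝ => z + t • v) (𝓝[>] 0) (𝓝 z) := by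
      have : Continuous fun t : ℝ => z + t • v := by fun_prop
      simpa using (this.tendsto 0).mono_left nhdsWithin_le_nhds
    refine le_of_tendsto hline.tendsto_slope_zero_right ?_
    filter_upwards [ht.eventually hL, ht.eventually hmin, self_mem_nhdsWithin] with t h1 h2 h3
    have h3' : 0 < t := h3
    rw [add_sub_cancel_left, map_smul_eq_mul, Real.norm_of_nonneg h3'.le] at h1
    have h4 := (le_abs_self _).trans h1
    simp only [zero_add, zero_smul, add_zero, smul_eq_mul]
    rw [inv_mul_le_iff₀ h3']
    linarith
  refine abs_le.2 ⟨?_, key v⟩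
  have := key (-v)
  rw [map_neg, map_neg_eq_map] at this
  linarith

/-- A fuzzy sum rule. The statement with the Lipschitz assumption on the second function. -/
theorem IsUnitBump.fuzzy_sum_rule_aux [CompleteSpace X] {b : X → ℝ} {K : NNReal}
    (hb : IsUnitBump b K) (p : Seminorm ℝ X) {k : ℝ} (hk : 1 ≤ k)
    (hp : ∀ v, k⁻¹ * ‖v‖ ≤ p v ∧ p v ≤ k * ‖v‖) {f g : X → ℝ} {z₀ : X} {R : ℝ} (hR : 0 < R)
    (hf : LowerSemicontinuousOn f (Metric.closedBall z₀ R))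
    (hg : LowerSemicontinuousOn g (Metric.closedBall z₀ R)) {B : ℝ}
    (hfB : ∀ x ∈ Metric.closedBall z₀ R, |f x| ≤ B)
    (hgB : ∀ x ∈ Metric.closedBall z₀ R, |g x| ≤ B) {L : ℝ} (hL : 0 ≤ L)
    (hlip : ∀ x ∈ Metric.closedBall z₀ R, ∀ y ∈ Metric.closedBall z₀ R,
      |g x - g y| ≤ L * ‖x - y‖) {ε : ℝ} (hε : 0 < ε)
    (hmin : ∀ x ∈ Metric.closedBall z₀ R, f z₀ + g z₀ ≤ f x + g x + ε * p (x - z₀))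
    {δ : ℝ} (hδ : 0 < δ) :
    ∃ x ∈ Metric.ball z₀ δ, ∃ y ∈ Metric.ball z₀ δ, ∃ G₁ G₂ : X → ℝ,
      ContDiff ℝ 1 G₁ ∧ ContDiff ℝ 1 G₂ ∧ IsLocalMin (fun x' => f x' - G₁ x') x ∧
      IsLocalMin (fun y' => g y' - G₂ y') y ∧ f x + g y ≤ f z₀ + g z₀ + δ ∧
      ∀ v, |fderiv ℝ G₁ x v + fderiv ℝ G₂ y v| ≤ (2 * ε + δ) * p v := by
  have hk0 : 0 < k := by linarith
  have hz₀ : z₀ ∈ Metric.closedBall z₀ R := Metric.mem_closedBall_self hR.le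
  have hB : 0 ≤ B := (abs_nonneg _).trans (hfB z₀ hz₀)
  obtain ⟨d, hd, hdδ, hdR⟩ : ∃ d : ℝ, 0 < d ∧ d ≤ δ ∧ d ≤ R :=
    ⟨min δ R, lt_min hδ hR, min_le_left _ _, min_le_right _ _⟩
  obtain ⟨η, hη, hη1, hη2, hη3, hη4⟩ : ∃ η : ℝ, 0 < η ∧ η ≤ 1 ∧ η ≤ δ ∧ 3 * η * k ≤ δ ∧
      η * k ≤ ε * (d / 8) := by
    refine ⟨min (min 1 δ) (min (δ / (3 * k)) (ε * (d / 8) / k)), by positivity,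
      (min_le_left _ _).trans (min_le_left _ _), (min_le_left _ _).trans (min_le_right _ _),
      ?_, ?_⟩
    · have : min (min 1 δ) (min (δ / (3 * k)) (ε * (d / 8) / k)) ≤ δ / (3 * k) :=
        (min_le_right _ _).trans (min_le_left _ _)
      rw [le_div_iff₀ (by positivity)] at this
      linarith
    · have : min (min 1 δ) (min (δ / (3 * k)) (ε * (d / 8) / k)) ≤ ε * (d / 8) / k :=
        (min_le_right _ _).trans (min_le_right _ _)
      rwa [le_div_iff₀ (by positivity)] at this
  obtain ⟨s, hs, hs1, hs2⟩ : ∃ s : ℝ, 0 < s ∧ s ≤ d / 8 ∧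
      s * ((L + 2 * ε * k) * k) ≤ ε * (d / 8) := by
    refine ⟨min (d / 8) (ε * (d / 8) / ((L + 2 * ε * k) * k)), by positivity, min_le_left _ _, ?_⟩
    rw [← le_div_iff₀ (by positivity)]
    exact min_le_right _ _
  -- At the perturbed minimum the penalties are at most `4B + η < A`, while `Q` equals `A` outside
  -- the ball of radius `s`: a bounded smooth penalty still forces the variables within `s` of each
  -- other.
  set A : ℝ := 4 * B + 2 with hA
  set Q : X → ℝ := fun x => A * (1 - b (s⁻¹ • x)) with hQ
  have hQc : ContDiff ℝ 1 Q := by have := hb.contDiff; fun_prop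
  have hQ0 : Q 0 = 0 := by simp [hQ, hb.apply_zero]
  have hQnn : ∀ x, 0 ≤ Q x := fun x =>
    mul_nonneg (by positivity) (by linarith [hb.le_one (s⁻¹ • x)])
  have hQA : ∀ x, Q x < A → ‖x‖ < s := by
    intro x hx
    by_contra! h
    have : 1 ≤ ‖s⁻¹ • x‖ := by
      rw [norm_smul, norm_inv, Real.norm_of_nonneg hs.le, le_inv_mul_iff₀ hs]; linarith
    simp [hQ, hb.eq_zero _ this] at hx
  set P : X × X × X → ℝ := fun w => Q (w.1 - w.2.1) + Q (w.1 - w.2.2) with hP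
  have hPc : ContDiff ℝ 1 P := by fun_prop
  -- `P` depends only on differences, so it is invariant under diagonal translations.
  have hPdiag : ∀ (w : X × X × X) (v : X), fderiv ℝ P w (v, v, v) = 0 := by
    intro w v
    have h1 : HasDerivAt (fun t : ℝ => P (w + t • (v, v, v))) (fderiv ℝ P w (v, v, v)) 0 :=
      ((hPc.differentiable one_ne_zero) w).hasFDerivAt.hasLineDerivAt _
    have h2 : (fun t : ℝ => P (w + t • (v, v, v))) = fun _ => P w := by
      ext t; simp [hP]
    rw [h2] at h1
    exact h1.unique (hasDerivAt_const _ _)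
  set cb : Set X := Metric.closedBall z₀ R with hcb
  set S : Set (X × X × X) := cb ×ˢ cb ×ˢ cb with hS
  have hpc : Continuous p := Seminorm.continuous_of_le (q := k.toNNReal • normSeminorm ℝ X)
    (by
      change Continuous fun x : X => k.toNNReal • ‖x‖
      fun_prop) (fun v => by
      change p v ≤ k.toNNReal • ‖v‖
      rw [NNReal.smul_def, Real.coe_toNNReal _ hk0.le]
      exact (hp v).2)
  -- The seminorm `p` need not be differentiable, so it gets a variable of its own. Its weight is
  -- `2ε` rather than `ε`: the surplus over `hmin` localizes the minimum near `z₀`.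
  set Φ : X × X × X → ℝ := fun w => f w.1 + g w.2.1 + (2 * ε * p (w.2.2 - z₀) + P w) with hΦ
  have hΦlsc : LowerSemicontinuousOn Φ S := by
    refine ((hf.comp_of_mapsTo continuous_fst.continuousOn fun w hw => hw.1).add
      (hg.comp_of_mapsTo (φ := fun w : X × X × X => w.2.1) (by fun_prop)
        fun w hw => hw.2.1)).add ?_
    have := hPc.continuous
    exact (by fun_prop : Continuous fun w : X × X × X =>
      2 * ε * p (w.2.2 - z₀) + P w).lowerSemicontinuous.lowerSemicontinuousOn _
  have hPnn : ∀ w, 0 ≤ P w := fun w => add_nonneg (hQnn _) (hQnn _)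
  have hΦbd : ∃ B', ∀ w ∈ S, B' ≤ Φ w := ⟨-(2 * B), fun w hw => by
    have h1 := (abs_le.1 (hfB _ hw.1)).1
    have h2 := (abs_le.1 (hgB _ hw.2.1)).1
    have h3 : 0 ≤ 2 * ε * p (w.2.2 - z₀) := by positivity
    have h4 := hPnn w
    simp only [hΦ]; linarith⟩
  have hScl : IsClosed S :=
    Metric.isClosed_closedBall.prod (Metric.isClosed_closedBall.prod Metric.isClosed_closedBall)
  obtain ⟨φ, hφc, hφ0, hφη, hφd, ⟨x, y, z⟩, hw, hwmin⟩ :=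
    (hb.prod (hb.prod hb)).exists_perturbed_min hScl ⟨(z₀, z₀, z₀), hz₀, hz₀, hz₀⟩ hΦlsc hΦbd hη
  obtain ⟨hx, hy, hz⟩ : x ∈ cb ∧ y ∈ cb ∧ z ∈ cb := ⟨hw.1, hw.2.1, hw.2.2⟩
  have hm : f x + g y + 2 * ε * p (z - z₀) + Q (x - y) + Q (x - z) ≤ f z₀ + g z₀ + η := by
    have h1 := hwmin (z₀, z₀, z₀) ⟨hz₀, hz₀, hz₀⟩
    have h2 := hφ0 (z₀, z₀, z₀)
    have h3 := hφη (x, y, z)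
    simp only [hΦ, hP, sub_self, hQ0, map_zero, mul_zero] at h1
    linarith
  have hpz : 0 ≤ 2 * ε * p (z - z₀) := by positivity
  have hxy : ‖x - y‖ < s ∧ ‖x - z‖ < s := by
    have h1 := abs_le.1 (hfB _ hx)
    have h2 := abs_le.1 (hgB _ hy)
    have h3 := abs_le.1 (hfB _ hz₀)
    have h4 := abs_le.1 (hgB _ hz₀)
    have h5 := hQnn (x - y)
    have h6 := hQnn (x - z)
    exact ⟨hQA _ (by linarith), hQA _ (by linarith)⟩
  -- Compare `hm` with `hmin` at `x`. The Lipschitz bound is used only here, to replace `g y` by `g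
  -- x`; what remains is `ε p(x - z₀) ≤ η + s(L + 2εk)`, small by the choice of `η` and `s`.
  have hxz₀ : ‖x - z₀‖ ≤ d / 4 := by
    have h1 := hmin x hx
    have h2 := (abs_le.1 (hlip x hx y hy)).2
    have h3 : p (x - z₀) ≤ p (z - z₀) + k * s := by
      have h4 := map_add_le_add p (z - z₀) (x - z)
      rw [sub_add_sub_cancel'] at h4
      have h5 : p (x - z) ≤ k * s := (hp _).2.trans (by gcongr; exact hxy.2.le)
      linarith
    have h6 : L * ‖x - y‖ ≤ L * s := by gcongr; exact hxy.1.le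
    have h7 := hQnn (x - y)
    have h8 := hQnn (x - z)
    have h9 : ε * p (x - z₀) ≤ η + s * (L + 2 * ε * k) := by nlinarith
    have h10 := (hp (x - z₀)).1
    rw [inv_mul_le_iff₀ hk0] at h10
    have h11 : ε * ‖x - z₀‖ ≤ ε * (d / 4) := by
      calc ε * ‖x - z₀‖ ≤ ε * (k * p (x - z₀)) := by gcongr
        _ = k * (ε * p (x - z₀)) := by ring
        _ ≤ k * (η + s * (L + 2 * ε * k)) := by gcongr
        _ = η * k + s * ((L + 2 * ε * k) * k) := by ring
        _ ≤ ε * (d / 4) := by linarith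
    exact le_of_mul_le_mul_left h11 hε
  have hyz₀ : ‖y - z₀‖ < d := by
    have := norm_sub_le (x - z₀) (x - y)
    rw [sub_sub_sub_cancel_left] at this
    linarith [hxy.1]
  have hzz₀ : ‖z - z₀‖ < d := by
    have := norm_sub_le (x - z₀) (x - z)
    rw [sub_sub_sub_cancel_left] at this
    linarith [hxy.2]
  have hnhds : ∀ a, ‖a - z₀‖ < d → cb ∈ 𝓝 a := fun a ha =>
    mem_of_superset (Metric.isOpen_ball.mem_nhds (mem_ball_iff_norm.2 (ha.trans_le hdR)))
      Metric.ball_subset_closedBall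
  set Ψ : X × X × X → ℝ := fun w => P w - φ w with hΨ
  have hΨc : ContDiff ℝ 1 Ψ := hPc.sub hφc
  have hΨd : HasFDerivAt Ψ (fderiv ℝ Ψ (x, y, z)) (x, y, z) :=
    (hΨc.differentiable one_ne_zero _).hasFDerivAt
  have hmin' : ∀ x' ∈ cb, ∀ y' ∈ cb, ∀ z' ∈ cb,
      f x + g y + 2 * ε * p (z - z₀) + Ψ (x, y, z) ≤
        f x' + g y' + 2 * ε * p (z' - z₀) + Ψ (x', y', z') := by
    intro x' hx' y' hy' z' hz'
    have := hwmin (x', y', z') ⟨hx', hy', hz'⟩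
    simp only [hΦ, hΨ] at this ⊢
    linarith
  have d1 : ∀ v, fderiv ℝ (fun x' => -Ψ (x', y, z)) x v = -fderiv ℝ Ψ (x, y, z) (v, 0, 0) := by
    intro v
    have h : HasFDerivAt (fun x' : X => (x', y, z)) _ x :=
      (hasFDerivAt_id (𝕜 := ℝ) x).prodMk ((hasFDerivAt_const y x).prodMk (hasFDerivAt_const z x))
    exact DFunLike.congr_fun (HasFDerivAt.comp x hΨd h).neg.fderiv v
  have d2 : ∀ v, fderiv ℝ (fun y' => -Ψ (x, y', z)) y v = -fderiv ℝ Ψ (x, y, z) (0, v, 0) := by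
    intro v
    have h : HasFDerivAt (fun y' : X => (x, y', z)) _ y :=
      (hasFDerivAt_const (𝕜 := ℝ) x y).prodMk ((hasFDerivAt_id y).prodMk (hasFDerivAt_const z y))
    exact DFunLike.congr_fun (HasFDerivAt.comp y hΨd h).neg.fderiv v
  have d3 : ∀ v, fderiv ℝ (fun z' => -Ψ (x, y, z')) z v = -fderiv ℝ Ψ (x, y, z) (0, 0, v) := by
    intro v
    have h : HasFDerivAt (fun z' : X => (x, y, z')) _ z :=
      (hasFDerivAt_const (𝕜 := ℝ) x z).prodMk ((hasFDerivAt_const y z).prodMk (hasFDerivAt_id z))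
    exact DFunLike.congr_fun (HasFDerivAt.comp z hΨd h).neg.fderiv v
  have b3 : ∀ v, |fderiv ℝ Ψ (x, y, z) (0, 0, v)| ≤ 2 * ε * p v := by
    intro v
    rw [← abs_neg, ← d3]
    refine abs_fderiv_le_of_isLocalMin_sub (h := fun z' => 2 * ε * p (z' - z₀)) ?_ ?_ ?_ v
    · have : ContDiff ℝ 1 fun z' => -Ψ (x, y, z') := by fun_prop
      exact this.differentiable one_ne_zero _
    · filter_upwards [hnhds z hzz₀] with z' hz'
      have := hmin' x hx y hy z' hz'
      linarith
    · refine Eventually.of_forall fun z' => ?_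
      rw [← mul_sub, abs_mul, abs_of_pos (by positivity : 0 < 2 * ε)]
      gcongr
      have := abs_sub_map_le_sub p (z' - z₀) (z - z₀)
      rwa [sub_sub_sub_cancel_right] at this
  refine ⟨x, ?_, y, ?_, fun x' => -Ψ (x', y, z), fun y' => -Ψ (x, y', z), by fun_prop,
    by fun_prop, ?_, ?_, ?_, fun v => ?_⟩
  · rw [mem_ball_iff_norm]; linarith
  · rw [mem_ball_iff_norm]; linarith
  · filter_upwards [hnhds x (by linarith)] with x' hx'
    have := hmin' x' hx' y hy z hz
    linarith
  · filter_upwards [hnhds y hyz₀] with y' hy'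
    have := hmin' x hx y' hy' z hz
    linarith
  · linarith [hQnn (x - y), hQnn (x - z)]
  -- The partial derivatives of `Ψ` add up to its diagonal derivative, to which only `φ`
  -- contributes; the `z`-part is bounded by `2ε p`, leaving the sum of the other two.
  · have hsum : fderiv ℝ Ψ (x, y, z) (v, v, v) = fderiv ℝ Ψ (x, y, z) (v, 0, 0) +
        fderiv ℝ Ψ (x, y, z) (0, v, 0) + fderiv ℝ Ψ (x, y, z) (0, 0, v) := by
      rw [← map_add, ← map_add]; simp
    have hΨP : fderiv ℝ Ψ (x, y, z) (v, v, v) = -fderiv ℝ φ (x, y, z) (v, v, v) := by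
      have : fderiv ℝ Ψ (x, y, z) = fderiv ℝ P (x, y, z) - fderiv ℝ φ (x, y, z) :=
        fderiv_fun_sub (hPc.differentiable one_ne_zero _) (hφc.differentiable one_ne_zero _)
      rw [this, sub_apply, hPdiag, zero_sub]
    have hφb : |fderiv ℝ φ (x, y, z) (v, v, v)| ≤ δ * p v := by
      have h1 : ‖fderiv ℝ φ (x, y, z) (v, v, v)‖ ≤ η * ‖v‖ := by
        refine (ContinuousLinearMap.le_of_opNorm_le _ (hφd _) _).trans_eq ?_
        simp [Prod.norm_def]
      have h2 := (hp v).1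
      rw [inv_mul_le_iff₀ hk0] at h2
      have h3 : 0 ≤ p v := apply_nonneg p v
      have h4 : η * ‖v‖ ≤ η * (k * p v) := by gcongr
      have h5 : 0 ≤ η * k * p v := by positivity
      have h6 : 3 * η * k * p v ≤ δ * p v := by gcongr
      rw [Real.norm_eq_abs] at h1
      linarith
    have h3 := abs_le.1 (b3 v)
    have h4 := abs_le.1 hφb
    rw [d1, d2, abs_le]
    constructor <;> linarith [h3.1, h3.2, h4.1, h4.2]

/-- A fuzzy sum rule: if `f + g + ε p(· - z₀)` has a minimum at `z₀` and one of `f`, `g` is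
Lipschitz, there are almost opposite test functions at points close to `z₀`. -/
theorem IsUnitBump.fuzzy_sum_rule [CompleteSpace X] {b : X → ℝ} {K : NNReal}
    (hb : IsUnitBump b K) (p : Seminorm ℝ X) {k : ℝ} (hk : 1 ≤ k)
    (hp : ∀ v, k⁻¹ * ‖v‖ ≤ p v ∧ p v ≤ k * ‖v‖) {f g : X → ℝ} {z₀ : X} {R : ℝ} (hR : 0 < R)
    (hf : LowerSemicontinuousOn f (Metric.closedBall z₀ R))
    (hg : LowerSemicontinuousOn g (Metric.closedBall z₀ R)) {B : ℝ}
    (hfB : ∀ x ∈ Metric.closedBall z₀ R, |f x| ≤ B)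
    (hgB : ∀ x ∈ Metric.closedBall z₀ R, |g x| ≤ B) {L : ℝ} (hL : 0 ≤ L)
    (hlip : (∀ x ∈ Metric.closedBall z₀ R, ∀ y ∈ Metric.closedBall z₀ R,
      |f x - f y| ≤ L * ‖x - y‖) ∨ (∀ x ∈ Metric.closedBall z₀ R,
      ∀ y ∈ Metric.closedBall z₀ R, |g x - g y| ≤ L * ‖x - y‖)) {ε : ℝ} (hε : 0 < ε)
    (hmin : ∀ x ∈ Metric.closedBall z₀ R, f z₀ + g z₀ ≤ f x + g x + ε * p (x - z₀))
    {δ : ℝ} (hδ : 0 < δ) :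
    ∃ x ∈ Metric.ball z₀ δ, ∃ y ∈ Metric.ball z₀ δ, ∃ G₁ G₂ : X → ℝ,
      ContDiff ℝ 1 G₁ ∧ ContDiff ℝ 1 G₂ ∧ IsLocalMin (fun x' => f x' - G₁ x') x ∧
      IsLocalMin (fun y' => g y' - G₂ y') y ∧ f x + g y ≤ f z₀ + g z₀ + δ ∧
      ∀ v, |fderiv ℝ G₁ x v + fderiv ℝ G₂ y v| ≤ (2 * ε + δ) * p v := by
  rcases hlip with hlip | hlip
  · obtain ⟨x, hx, y, hy, G₁, G₂, h1, h2, h3, h4, h5, h6⟩ :=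
      hb.fuzzy_sum_rule_aux p hk hp hR hg hf hgB hfB hL hlip hε
        (fun x hx => by linarith [hmin x hx]) hδ
    exact ⟨y, hy, x, hx, G₂, G₁, h2, h1, h4, h3, by linarith, fun v => by
      rw [add_comm]; exact h6 v⟩
  · exact hb.fuzzy_sum_rule_aux p hk hp hR hf hg hfB hgB hL hlip hε hmin hδ

end FuzzySum

/-! ### Ekeland's variational principle -/

/-- Ekeland's variational principle for a complete pseudometric `d` and a function `f` which is
lower semicontinuous along `d`-convergent sequences. -/
theorem exists_ekeland {M : Type*} (d : M → M → ℝ) (d_nonneg : ∀ x y, 0 ≤ d x y)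
    (d_self : ∀ x, d x x = 0) (d_comm : ∀ x y, d x y = d y x)
    (d_triangle : ∀ x y z, d x z ≤ d x y + d y z)
    (complete : ∀ s : ℕ → M, (∀ ε : ℝ, 0 < ε → ∃ k, ∀ m ≥ k, ∀ n ≥ k, d (s m) (s n) < ε) →
      ∃ x, Tendsto (fun n => d (s n) x) atTop (𝓝 0))
    {f : M → ℝ} (lsc : ∀ (s : ℕ → M) (x : M), Tendsto (fun n => d (s n) x) atTop (𝓝 0) →
      ∀ c < f x, ∀ᶠ n in atTop, c < f (s n))
    (hbdd : ∃ B, ∀ x, B ≤ f x) {ε : ℝ} (hε : 0 < ε) (a : M) :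
    ∃ x, f x ≤ f a ∧ ∀ y, f x ≤ f y + ε * d x y := by
  -- From `x`, move to a `2⁻ⁿ`-minimizer of `f` among the points that improve on `x` at slope `ε`.
  -- These sets are nested along the sequence.
  have hpick : ∀ (n : ℕ) (x : M), ∃ w, f w + ε * d x w ≤ f x ∧
      ∀ y, f y + ε * d x y ≤ f x → f w ≤ f y + (1 / 2 : ℝ) ^ n := by
    intro n x
    obtain ⟨B, hB⟩ := hbdd
    exact exists_approx_min (S := {y | f y + ε * d x y ≤ f x}) ⟨x, by simp [d_self]⟩
      ⟨B, fun y _ => hB y⟩ (by positivity)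
  choose pick hpick1 hpick2 using hpick
  let s : ℕ → M := fun n => Nat.rec a pick n
  have hs1 : ∀ n, f (s (n + 1)) + ε * d (s n) (s (n + 1)) ≤ f (s n) := fun n => hpick1 n (s n)
  have hs2 : ∀ n y, f y + ε * d (s n) y ≤ f (s n) → f (s (n + 1)) ≤ f y + (1 / 2 : ℝ) ^ n :=
    fun n => hpick2 n (s n)
  have hchain : ∀ m n, m ≤ n → f (s n) + ε * d (s m) (s n) ≤ f (s m) := by
    intro m n hmn
    induction n, hmn using Nat.le_induction with
    | base => simp [d_self]
    | succ n _ ih =>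
      have h1 := hs1 n
      have h2 := mul_le_mul_of_nonneg_left (d_triangle (s m) (s n) (s (n + 1))) hε.le
      linarith
  have hanti : Antitone fun n => f (s n) := antitone_nat_of_succ_le fun n => by
    have h1 := hs1 n
    have h2 := mul_nonneg hε.le (d_nonneg (s n) (s (n + 1)))
    linarith
  have hbelow : BddBelow (range fun n => f (s n)) := by
    obtain ⟨B, hB⟩ := hbdd
    exact ⟨B, by rintro _ ⟨n, rfl⟩; exact hB _⟩
  have hlim := tendsto_atTop_ciInf hanti hbelow
  set ℓ := ⨅ n, f (s n)
  have hle : ∀ n, ℓ ≤ f (s n) := fun n => ciInf_le hbelow n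
  obtain ⟨x, hx⟩ := complete s fun r hr => by
    obtain ⟨k, hk⟩ := (hlim.eventually (gt_mem_nhds (lt_add_of_pos_right ℓ
      (by positivity : 0 < ε * r)))).exists
    have key : ∀ m ≥ k, ∀ n ≥ m, d (s m) (s n) < r := fun m hm n hn => by
      have h1 := hchain m n hn
      have h2 : f (s m) ≤ f (s k) := hanti hm
      have h3 := hle n
      exact lt_of_mul_lt_mul_left (by linarith : ε * d (s m) (s n) < ε * r) hε.le
    refine ⟨k, fun m hm n hn => ?_⟩
    rcases le_total m n with h | h
    · exact key m hm n h
    · rw [d_comm]; exact key n hn m h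
  have hxs : ∀ m, f x + ε * d (s m) x ≤ f (s m) := by
    intro m
    refine le_of_forall_pos_le_add fun r hr => ?_
    have h1 := lsc s x hx (f x - r / 2) (by linarith)
    have h2 : ∀ᶠ n in atTop, ε * d (s n) x < r / 2 := by
      have := hx.const_mul ε
      rw [mul_zero] at this
      exact this.eventually (gt_mem_nhds (by linarith))
    obtain ⟨n, hn1, hn2, hn3⟩ := (h1.and (h2.and (eventually_ge_atTop m))).exists
    have h3 := hchain m n hn3
    have h4 := mul_le_mul_of_nonneg_left (d_triangle (s m) (s n) x) hε.le
    linarith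
  refine ⟨x, ?_, fun y => ?_⟩
  · have h1 := hxs 0
    have h2 := mul_nonneg hε.le (d_nonneg (s 0) x)
    change f x + _ ≤ f a at h1
    linarith
  -- A violating `y` would lie in all the nested sets, so the approximate minimality of each step
  -- gives `f x ≤ f y` in the limit.
  · by_contra! hlt
    have hn : ∀ n : ℕ, f x ≤ f y + (1 / 2 : ℝ) ^ n := fun n => by
      have h1 : f y + ε * d (s n) y ≤ f (s n) := by
        have h2 := hxs n
        have h3 := mul_le_mul_of_nonneg_left (d_triangle (s n) x y) hε.le
        linarith
      have h2 := hs2 n y h1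
      have h3 := hxs (n + 1)
      have h4 := mul_nonneg hε.le (d_nonneg (s (n + 1)) x)
      linarith
    have h5 : f x ≤ f y := by
      have := (tendsto_pow_atTop_nhds_zero_of_lt_one (r := (1 / 2 : ℝ)) (by norm_num)
        (by norm_num)).const_add (f y)
      rw [add_zero] at this
      exact ge_of_tendsto' this hn
    have h6 := mul_nonneg hε.le (d_nonneg x y)
    linarith

/-! ### The Finsler distance -/

namespace FinslerStructure

variable {X : Type*} [NormedAddCommGroup X] [NormedSpace ℝ X]
  {M : Type*} [TopologicalSpace M] [ChartedSpace X M] [IsManifold 𝓘(ℝ, X) 1 M]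
  (F : FinslerStructure X M)

section Distance

/-- The extended norms on the tangent spaces given by a Finsler structure. -/
@[reducible]
noncomputable def tangentENorm (x : M) : ENorm (TangentSpace 𝓘(ℝ, X) x) :=
  ⟨fun v => ENNReal.ofReal (F.normAt x v)⟩

theorem enormSMulClass_tangentENorm (x : M) :
    letI := F.tangentENorm x
    ENormSMulClass ℝ (TangentSpace 𝓘(ℝ, X) x) := by
  let := F.tangentENorm x
  refine ⟨fun c v => ?_⟩
  change ENNReal.ofReal (F.normAt x (c • v)) = ‖c‖ₑ * ENNReal.ofReal (F.normAt x v)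
  rw [map_smul_eq_mul, ENNReal.ofReal_mul (norm_nonneg c), ofReal_norm]

theorem pathLength_eq_pathELength (c : ℝ → M) (a b : ℝ) :
    F.pathLength c a b = letI := F.tangentENorm; Manifold.pathELength 𝓘(ℝ, X) c a b := by
  let := F.tangentENorm
  rw [Manifold.pathELength_eq_lintegral_mfderiv_Icc]
  rfl

theorem edist_le_pathLength {c : ℝ → M} {a b : ℝ} (hab : a ≤ b)
    (hc : ContMDiffOn 𝓘(ℝ, ℝ) 𝓘(ℝ, X) 1 c (Icc a b)) :
    F.edist (c a) (c b) ≤ F.pathLength c a b := by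
  refine sInf_le ⟨c, a, b, hab, ⟨1, fun i => if i = 0 then a else b, ?_, by simp, by simp, ?_⟩,
    rfl, rfl, rfl⟩
  · intro i j hij
    by_cases hi : i = 0 <;> by_cases hj : j = 0 <;> simp [hi, hj, hab]
    omega
  · intro i hi
    obtain rfl : i = 0 := by omega
    simpa using hc

/-- The Finsler distance, defined by piecewise `C¹` paths, may be computed with `C¹` paths. -/
theorem edist_eq_riemannianEDist (p q : M) :
    F.edist p q = letI := F.tangentENorm; Manifold.riemannianEDist 𝓘(ℝ, X) p q := by
  let := F.tangentENorm
  have := F.enormSMulClass_tangentENorm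
  refine le_antisymm (le_of_forall_gt fun r hr => ?_) (le_sInf ?_)
  · obtain ⟨γ, h0, h1, hγ, hlen⟩ := Manifold.exists_lt_of_riemannianEDist_lt hr
    rw [← h0, ← h1]
    refine (F.edist_le_pathLength zero_le_one hγ).trans_lt ?_
    rwa [pathLength_eq_pathELength]
  -- Corners cost nothing: induct on the number of pieces, using the triangle inequality for the
  -- `C¹` distance and additivity of length.
  · rintro _ ⟨c, a, b, hab, ⟨n, t, ht, h0, hn, hc⟩, rfl, rfl, rfl⟩
    rw [pathLength_eq_pathELength]
    subst h0 hn
    clear hab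
    induction n with
    | zero => simp [Manifold.riemannianEDist_self]
    | succ n ih =>
      rw [← Manifold.pathELength_add (ht (Nat.zero_le n)) (ht n.le_succ)]
      refine Manifold.riemannianEDist_triangle.trans (add_le_add (ih fun i hi => hc i (by omega)) ?_)
      exact Manifold.riemannianEDist_le_pathELength (hc n n.lt_succ_self) rfl rfl (ht n.le_succ)

theorem edist_self (p : M) : F.edist p p = 0 := by
  let := F.tangentENorm
  have := F.enormSMulClass_tangentENorm
  rw [edist_eq_riemannianEDist]
  exact Manifold.riemannianEDist_self

theorem edist_comm (p q : M) : F.edist p q = F.edist q p := by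
  let := F.tangentENorm
  have := F.enormSMulClass_tangentENorm
  rw [edist_eq_riemannianEDist, edist_eq_riemannianEDist]
  exact Manifold.riemannianEDist_comm

theorem edist_triangle (p q r : M) : F.edist p r ≤ F.edist p q + F.edist q r := by
  let := F.tangentENorm
  have := F.enormSMulClass_tangentENorm
  simp only [edist_eq_riemannianEDist]
  exact Manifold.riemannianEDist_triangle

/-- A `C¹` function whose differential is bounded by `K` is `K`-Lipschitz. -/
theorem enorm_sub_le_mul_edist {β : M → ℝ} (hβ : ContMDiff 𝓘(ℝ, X) 𝓘(ℝ, ℝ) 1 β) {K : ℝ}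
    (hK : 0 < K) (hbound : ∀ x (ξ : TangentSpace 𝓘(ℝ, X) x),
      |mvfderiv 𝓘(ℝ, X) β x ξ| ≤ K * F.normAt x ξ) (p q : M) :
    ‖β q - β p‖ₑ ≤ ENNReal.ofReal K * F.edist p q := by
  let := F.tangentENorm
  have := F.enormSMulClass_tangentENorm
  have key : ∀ γ : ℝ → M, γ 0 = p → γ 1 = q →
      ContMDiffOn 𝓘(ℝ, ℝ) 𝓘(ℝ, X) 1 γ (Icc 0 1) →
      ‖β q - β p‖ₑ ≤ ENNReal.ofReal K * Manifold.pathELength 𝓘(ℝ, X) γ 0 1 := by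
    rintro γ rfl rfl hγ
    have D : ContDiffOn ℝ 1 (β ∘ γ) (Icc 0 1) :=
      contMDiffOn_iff_contDiffOn.mp (hβ.comp_contMDiffOn hγ)
    refine (enorm_sub_le_lintegral_derivWithin_Icc_of_contDiffOn_Icc D zero_le_one).trans ?_
    rw [Manifold.pathELength_eq_lintegral_mfderivWithin_Icc,
      ← lintegral_const_mul' _ _ ENNReal.ofReal_ne_top]
    refine setLIntegral_mono' measurableSet_Icc fun t ht => ?_
    have hcomp : derivWithin (β ∘ γ) (Icc 0 1) t =
        mvfderiv 𝓘(ℝ, X) β (γ t) (mfderivWithin 𝓘(ℝ, ℝ) 𝓘(ℝ, X) γ (Icc 0 1) t (1 : ℝ)) := by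
      have h1 := mfderiv_comp_mfderivWithin t (hβ.mdifferentiable one_ne_zero (γ t))
        (hγ.mdifferentiableOn one_ne_zero t ht)
        ((uniqueMDiffWithinAt_iff_uniqueDiffWithinAt).2 (uniqueDiffOn_Icc zero_lt_one t ht))
      rw [← fderivWithin_derivWithin, ← mfderivWithin_eq_fderivWithin, h1]
      rfl
    rw [hcomp]
    change _ ≤ ENNReal.ofReal K * ENNReal.ofReal _
    rw [← ENNReal.ofReal_mul hK.le, ← ofReal_norm]
    exact ENNReal.ofReal_le_ofReal (hbound _ _)
  have hK' : ENNReal.ofReal K ≠ 0 := by simpa using hK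
  rw [← ENNReal.div_le_iff' hK' ENNReal.ofReal_ne_top, edist_eq_riemannianEDist]
  refine le_of_forall_gt fun r hr => ?_
  obtain ⟨γ, h0, h1, hγ, hlen⟩ := Manifold.exists_lt_of_riemannianEDist_lt hr
  refine lt_of_le_of_lt ?_ hlen
  rw [ENNReal.div_le_iff' hK' ENNReal.ofReal_ne_top]
  exact key γ h0 h1 hγ

end Distance

end FinslerStructure

/-! ### Finsler norms and distance in charts -/

namespace FinslerStructure

variable {X : Type*} [NormedAddCommGroup X] [NormedSpace ℝ X]
  {M : Type*} [TopologicalSpace M] [ChartedSpace X M] [IsManifold 𝓘(ℝ, X) 1 M]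
  (F : FinslerStructure X M)

section Charts

/-- The norm of the tangent space at the point of coordinate `y` in the preferred chart at `x₀`,
read in this chart. -/
noncomputable def chartSeminorm (x₀ : M) (y : X) : Seminorm ℝ X :=
  (F.normAt ((chartAt X x₀).symm y)).comp
    (mfderiv 𝓘(ℝ, X) 𝓘(ℝ, X) (chartAt X x₀).symm y).toLinearMap

theorem chartSeminorm_apply (x₀ : M) (y v : X) : F.chartSeminorm x₀ y v =
    F.normAt ((chartAt X x₀).symm y) (mfderiv 𝓘(ℝ, X) 𝓘(ℝ, X) (chartAt X x₀).symm y v) := rfl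

theorem chartNorm_eq_chartSeminorm (x₀ x : M) (v : X) :
    chartNorm F.normAt (chartAt X x₀) x v = F.chartSeminorm x₀ (chartAt X x₀ x) v := rfl

/-- A ball in the preferred chart at `x₀` on which the Finsler norms are `(1 + κ)`-equivalent to
the one at `x₀`. -/
structure IsAdaptedBall (x₀ : M) (κ R : ℝ) : Prop where
  pos : 0 < R
  subset_target : Metric.closedBall (chartAt X x₀ x₀) R ⊆ (chartAt X x₀).target
  le_mul : ∀ y ∈ Metric.closedBall (chartAt X x₀ x₀) R, ∀ v,
    F.chartSeminorm x₀ y v ≤ (1 + κ) * F.chartSeminorm x₀ (chartAt X x₀ x₀) v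
  mul_ge : ∀ y ∈ Metric.closedBall (chartAt X x₀ x₀) R, ∀ v,
    F.chartSeminorm x₀ (chartAt X x₀ x₀) v ≤ (1 + κ) * F.chartSeminorm x₀ y v

theorem exists_isAdaptedBall (x₀ : M) {κ : ℝ} (hκ : 0 < κ) {U : Set M} (hU : U ∈ 𝓝 x₀) :
    ∃ R, F.IsAdaptedBall x₀ κ R ∧
      ∀ y ∈ Metric.closedBall (chartAt X x₀ x₀) R, (chartAt X x₀).symm y ∈ U := by
  set e := chartAt X x₀ with he
  have hx₀ : x₀ ∈ e.source := mem_chart_source X x₀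
  obtain ⟨W, hWo, hxW, hWs, hW⟩ := F.palais e (IsManifold.chart_mem_maximalAtlas x₀) x₀ hx₀ κ hκ
  have h1 : e.symm ⁻¹' (W ∩ U) ∈ 𝓝 (e x₀) := by
    refine (e.continuousAt_symm (e.map_source hx₀)).preimage_mem_nhds ?_
    rw [e.left_inv hx₀]
    exact inter_mem (hWo.mem_nhds hxW) hU
  obtain ⟨R, hR, hball⟩ := Metric.nhds_basis_closedBall.mem_iff.1
    (inter_mem (e.open_target.mem_nhds (e.map_source hx₀)) h1)
  have hbd : ∀ y ∈ Metric.closedBall (e x₀) R, ∀ v, (1 + κ)⁻¹ * F.chartSeminorm x₀ (e x₀) v ≤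
      F.chartSeminorm x₀ y v ∧
      F.chartSeminorm x₀ y v ≤ (1 + κ) * F.chartSeminorm x₀ (e x₀) v := by
    intro y hy v
    have := hW (e.symm y) (hball hy).2.1 v
    rwa [he, chartNorm_eq_chartSeminorm, chartNorm_eq_chartSeminorm, ← he,
      e.right_inv (hball hy).1] at this
  refine ⟨R, ⟨hR, fun y hy => (hball hy).1, fun y hy v => (hbd y hy v).2, fun y hy v => ?_⟩,
    fun y hy => (hball hy).2.2⟩
  rw [← inv_mul_le_iff₀ (by positivity)]
  exact (hbd y hy v).1

theorem exists_chartSeminorm_equiv (x₀ : M) : ∃ k : ℝ, 1 ≤ k ∧ ∀ v : X,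
    k⁻¹ * ‖v‖ ≤ F.chartSeminorm x₀ (chartAt X x₀ x₀) v ∧
      F.chartSeminorm x₀ (chartAt X x₀ x₀) v ≤ k * ‖v‖ :=
  F.equivalent _ (IsManifold.chart_mem_maximalAtlas x₀) x₀ (mem_chart_source X x₀)

theorem normAt_eq_chartSeminorm {x₀ x : M} (hx : x ∈ (chartAt X x₀).source)
    (ξ : TangentSpace 𝓘(ℝ, X) x) : F.normAt x ξ = F.chartSeminorm x₀ (chartAt X x₀ x)
      (mfderiv 𝓘(ℝ, X) 𝓘(ℝ, X) (chartAt X x₀) x ξ) := by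
  have h1 := (mdifferentiable_chart (I := 𝓘(ℝ, X)) x₀).symm_comp_deriv hx
  -- The base points `x` and `e.symm (e x)` agree only propositionally; generalizing `x'` transports
  -- the norm between their tangent spaces.
  have h2 : ∀ (x' : M) (_ : x' = x) (w : X), w = ξ → F.normAt x ξ = F.normAt x' w := by
    rintro _ rfl _ rfl; rfl
  exact h2 _ ((chartAt X x₀).left_inv hx) _ (DFunLike.congr_fun h1 ξ)

theorem exists_mfderiv_symm_eq {x₀ : M} {y : X} (hy : y ∈ (chartAt X x₀).target)
    (ξ : TangentSpace 𝓘(ℝ, X) ((chartAt X x₀).symm y)) :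
    ∃ w : X, mfderiv 𝓘(ℝ, X) 𝓘(ℝ, X) (chartAt X x₀).symm y w = ξ := by
  have h1 := (mdifferentiable_chart (I := 𝓘(ℝ, X)) x₀).symm.comp_symm_deriv
    (x := (chartAt X x₀).symm y) ((chartAt X x₀).map_target hy)
  rw [(chartAt X x₀).symm_symm, (chartAt X x₀).right_inv hy] at h1
  exact ⟨_, DFunLike.congr_fun h1 ξ⟩

-- The closed ball is convex, so the straight segment from `y` to `z` stays where `le_mul` bounds
-- its speed.
variable {F} in
theorem IsAdaptedBall.edist_le {x₀ : M} {κ R : ℝ} (h : F.IsAdaptedBall x₀ κ R) {y z : X}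
    (hy : y ∈ Metric.closedBall (chartAt X x₀ x₀) R)
    (hz : z ∈ Metric.closedBall (chartAt X x₀ x₀) R) :
    F.edist ((chartAt X x₀).symm y) ((chartAt X x₀).symm z) ≤
      ENNReal.ofReal ((1 + κ) * F.chartSeminorm x₀ (chartAt X x₀ x₀) (z - y)) := by
  set e := chartAt X x₀ with he
  set l : ℝ → X := fun t => y + t • (z - y) with hl
  have hlmem : ∀ t ∈ Icc (0 : ℝ) 1, l t ∈ Metric.closedBall (e x₀) R := fun t ht =>
    (convex_closedBall _ _).add_smul_sub_mem hy hz ht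
  have hlc : ContMDiff 𝓘(ℝ, ℝ) 𝓘(ℝ, X) 1 l := by
    rw [contMDiff_iff_contDiff]; fun_prop
  have hγ : ContMDiffOn 𝓘(ℝ, ℝ) 𝓘(ℝ, X) 1 (e.symm ∘ l) (Icc 0 1) :=
    (contMDiffOn_chart_symm (x := x₀)).comp hlc.contMDiffOn
      fun t ht => h.subset_target (hlmem t ht)
  have h0 : (e.symm ∘ l) 0 = e.symm y := by simp [hl]
  have h1 : (e.symm ∘ l) 1 = e.symm z := by simp [hl]
  rw [← h0, ← h1]
  refine (F.edist_le_pathLength zero_le_one hγ).trans ?_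
  have hbound : ∀ t ∈ Icc (0 : ℝ) 1, ENNReal.ofReal (F.normAt ((e.symm ∘ l) t)
      (mfderiv 𝓘(ℝ, ℝ) 𝓘(ℝ, X) (e.symm ∘ l) t (1 : ℝ))) ≤
      ENNReal.ofReal ((1 + κ) * F.chartSeminorm x₀ (e x₀) (z - y)) := by
    intro t ht
    refine ENNReal.ofReal_le_ofReal ?_
    have hd : mfderiv 𝓘(ℝ, ℝ) 𝓘(ℝ, X) (e.symm ∘ l) t (1 : ℝ) =
        mfderiv 𝓘(ℝ, X) 𝓘(ℝ, X) e.symm (l t) (z - y) := by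
      rw [mfderiv_comp t (I' := 𝓘(ℝ, X))
        ((mdifferentiable_chart (I := 𝓘(ℝ, X)) x₀).symm.mdifferentiableAt
          (h.subset_target (hlmem t ht))) (hlc.mdifferentiable one_ne_zero t), mfderiv_eq_fderiv]
      have : HasDerivAt l (z - y) t := by
        have h2 := ((hasDerivAt_id t).smul_const (z - y)).const_add y
        rwa [one_smul] at h2
      change mfderiv 𝓘(ℝ, X) 𝓘(ℝ, X) e.symm (l t) (fderiv ℝ l t 1) = _
      rw [fderiv_apply_one_eq_deriv, this.deriv]
    rw [hd]
    exact h.le_mul _ (hlmem t ht) _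
  refine (setLIntegral_mono' measurableSet_Icc hbound).trans_eq ?_
  simp

end Charts

/-! ### Finiteness of the distance on a connected manifold -/

section Finite

/-- Each point has a neighborhood of points at finite Finsler distance. -/
theorem eventually_edist_lt_top (x : M) : ∀ᶠ y in 𝓝 x, F.edist x y < ⊤ := by
  obtain ⟨R, hR, -⟩ := F.exists_isAdaptedBall x one_pos univ_mem
  have hx := mem_chart_source X x
  filter_upwards [(chartAt X x).open_source.mem_nhds hx,
    ((chartAt X x).continuousAt hx).preimage_mem_nhds
      (Metric.closedBall_mem_nhds _ hR.pos)] with y hy hyR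
  have := hR.edist_le (Metric.mem_closedBall_self hR.pos.le) hyR
  rw [(chartAt X x).left_inv hx, (chartAt X x).left_inv hy] at this
  exact this.trans_lt ENNReal.ofReal_lt_top

/-- Local finiteness and the triangle inequality make the set of points at finite distance from `x`
both open and closed. -/
theorem edist_ne_top [ConnectedSpace M] (x y : M) : F.edist x y ≠ ⊤ := by
  have h : IsClopen {z | F.edist x z < ⊤} := by
    refine ⟨⟨isOpen_iff_mem_nhds.2 fun z hz => ?_⟩, isOpen_iff_mem_nhds.2 fun z hz => ?_⟩
    · filter_upwards [F.eventually_edist_lt_top z] with w hw hxw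
      refine hz ((F.edist_triangle x w z).trans_lt (ENNReal.add_lt_top.2 ⟨hxw, ?_⟩))
      rwa [edist_comm]
    · filter_upwards [F.eventually_edist_lt_top z] with w hw
      exact (F.edist_triangle x z w).trans_lt (ENNReal.add_lt_top.2 ⟨hz, hw⟩)
  have hu := h.eq_univ ⟨x, by simp [edist_self]⟩
  exact ((Set.ext_iff.1 hu y).2 trivial).ne

theorem dist_nonneg (x y : M) : 0 ≤ F.dist x y := ENNReal.toReal_nonneg

theorem dist_self (x : M) : F.dist x x = 0 := by simp [dist, edist_self]

theorem dist_comm (x y : M) : F.dist x y = F.dist y x := by rw [dist, dist, edist_comm]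

theorem dist_triangle [ConnectedSpace M] (x y z : M) :
    F.dist x z ≤ F.dist x y + F.dist y z := by
  rw [dist, dist, dist, ← ENNReal.toReal_add (F.edist_ne_top _ _) (F.edist_ne_top _ _)]
  exact ENNReal.toReal_mono (ENNReal.add_ne_top.2 ⟨F.edist_ne_top _ _, F.edist_ne_top _ _⟩)
    (F.edist_triangle x y z)

variable {F} in
theorem IsAdaptedBall.dist_le {x₀ : M} {κ R : ℝ} (h : F.IsAdaptedBall x₀ κ R) (hκ : 0 ≤ κ)
    {y z : X} (hy : y ∈ Metric.closedBall (chartAt X x₀ x₀) R)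
    (hz : z ∈ Metric.closedBall (chartAt X x₀ x₀) R) :
    F.dist ((chartAt X x₀).symm y) ((chartAt X x₀).symm z) ≤
      (1 + κ) * F.chartSeminorm x₀ (chartAt X x₀ x₀) (z - y) :=
  ENNReal.toReal_le_of_le_ofReal (mul_nonneg (by linarith) (apply_nonneg _ _)) (h.edist_le hy hz)

end Finite

end FinslerStructure

/-! ### Cut-offs and extension of functions from a chart -/

section Extension

variable {X : Type*} [NormedAddCommGroup X] [NormedSpace ℝ X]
  {M : Type*} [TopologicalSpace M] [ChartedSpace X M] [IsManifold 𝓘(ℝ, X) 1 M]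

theorem contMDiffAt_comp_chartAt {x₀ x : M} (hx : x ∈ (chartAt X x₀).source) {G : X → ℝ}
    (hG : ContDiff ℝ 1 G) : ContMDiffAt 𝓘(ℝ, X) 𝓘(ℝ, ℝ) 1 (fun y => G (chartAt X x₀ y)) x :=
  hG.contMDiff.contMDiffAt.comp x
    ((contMDiffOn_chart (x := x₀)).contMDiffAt ((chartAt X x₀).open_source.mem_nhds hx))

theorem mvfderiv_apply_of_eventuallyEq_comp_chartAt {x₀ x : M} (hx : x ∈ (chartAt X x₀).source)
    {G : X → ℝ} (hG : ContDiff ℝ 1 G) {g : M → ℝ} (hg : g =ᶠ[𝓝 x] fun y => G (chartAt X x₀ y))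
    (ξ : TangentSpace 𝓘(ℝ, X) x) : mvfderiv 𝓘(ℝ, X) g x ξ =
      fderiv ℝ G (chartAt X x₀ x) (mfderiv 𝓘(ℝ, X) 𝓘(ℝ, X) (chartAt X x₀) x ξ) := by
  have h1 : mfderiv 𝓘(ℝ, X) 𝓘(ℝ, ℝ) g x = mfderiv 𝓘(ℝ, X) 𝓘(ℝ, ℝ) (G ∘ chartAt X x₀) x :=
    hg.mfderiv_eq
  have h2 := mfderiv_comp x (I' := 𝓘(ℝ, X)) (f := chartAt X x₀) (g := G)
    (hG.differentiable one_ne_zero _).mdifferentiableAt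
    ((mdifferentiable_chart (I := 𝓘(ℝ, X)) x₀).mdifferentiableAt hx)
  have h3 := DFunLike.congr_fun (h1.trans h2) ξ
  rw [mfderiv_eq_fderiv] at h3
  exact h3

/-- Cut-off functions: `β` is `1` near `x₀`, vanishes outside `U`, and is the composition of a
globally Lipschitz `C¹` function with the chart at `x₀`. -/
theorem exists_cutoff [RegularSpace M] {b : X → ℝ} {K : NNReal} (hb : IsUnitBump b K) (x₀ : M)
    {U : Set M} (hU : U ∈ 𝓝 x₀) : ∃ (β : M → ℝ) (B : X → ℝ) (L : NNReal),
      ContMDiff 𝓘(ℝ, X) 𝓘(ℝ, ℝ) 1 β ∧ (∀ᶠ x in 𝓝 x₀, β x = 1) ∧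
      tsupport β ⊆ U ∩ (chartAt X x₀).source ∧ ContDiff ℝ 1 B ∧ LipschitzWith L B ∧
      ∀ x ∈ (chartAt X x₀).source, β x = B (chartAt X x₀ x) := by
  classical
  set e := chartAt X x₀ with he
  have hx₀ : x₀ ∈ e.source := mem_chart_source X x₀
  -- The image of a closed chart ball need not be closed in `M` when `X` is infinite-dimensional. A
  -- closed neighborhood `V`, from regularity, keeps the support inside the chart, so that extension
  -- by zero is `C¹`.
  obtain ⟨V, ⟨hV, hVc⟩, hVU⟩ := (closed_nhds_basis x₀).mem_iff.1
    (inter_mem hU (e.open_source.mem_nhds hx₀))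
  have h1 : e.symm ⁻¹' V ∈ 𝓝 (e x₀) := by
    refine (e.continuousAt_symm (e.map_source hx₀)).preimage_mem_nhds ?_
    rwa [e.left_inv hx₀]
  obtain ⟨R, hR, hball⟩ := Metric.nhds_basis_ball.mem_iff.1 h1
  set B : X → ℝ := fun y => b (R⁻¹ • (y - e x₀)) with hB
  have hBc : ContDiff ℝ 1 B := by have := hb.contDiff; fun_prop
  have hBl : LipschitzWith (K * ‖R⁻¹‖₊) B := hb.lipschitz.comp
    (LipschitzWith.of_dist_le_mul fun x y => by rw [dist_smul₀, dist_sub_right]; simp)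
  set β : M → ℝ := fun x => if x ∈ e.source then B (e x) else 0 with hβ
  have hβe : ∀ x ∈ e.source, β x = B (e x) := fun x hx => if_pos hx
  have hβt : tsupport β ⊆ V := by
    refine closure_minimal (fun x hx => ?_) hVc
    by_cases hxs : x ∈ e.source
    · have hlt : ‖R⁻¹ • (e x - e x₀)‖ < 1 := by
        by_contra! h
        exact hx (by rw [hβe x hxs]; exact hb.eq_zero _ h)
      rw [norm_smul, norm_inv, Real.norm_of_nonneg hR.le, inv_mul_lt_iff₀ hR, mul_one] at hlt
      have := hball (mem_ball_iff_norm.2 hlt)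
      rwa [mem_preimage, e.left_inv hxs] at this
    · exact absurd (if_neg hxs) hx
  refine ⟨β, B, _, ?_, ?_, hβt.trans hVU, hBc, hBl, hβe⟩
  · refine contMDiff_of_tsupport fun x hx => ?_
    have hxs : x ∈ e.source := (hVU (hβt hx)).2
    refine (contMDiffAt_comp_chartAt hxs hBc).congr_of_eventuallyEq ?_
    filter_upwards [e.open_source.mem_nhds hxs] with y hy using hβe y hy
  · have h2 : ∀ᶠ y in 𝓝 (e x₀), B y = 1 := by
      have hc : Tendsto (fun y => R⁻¹ • (y - e x₀)) (𝓝 (e x₀)) (𝓝 0) := by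
        have : Continuous fun y : X => R⁻¹ • (y - e x₀) := by fun_prop
        simpa using this.tendsto (e x₀)
      exact hc.eventually hb.eventually_eq_one
    filter_upwards [e.open_source.mem_nhds hx₀, (e.continuousAt hx₀).eventually h2] with x hx hx'
    rw [hβe x hx, hx']

/-- `C¹` functions in the chart at `x₀` extend globally from a neighborhood of `x₀`. -/
theorem exists_contMDiff_extension [RegularSpace M] {b : X → ℝ} {K : NNReal}
    (hb : IsUnitBump b K) (x₀ : M) : ∃ U ∈ 𝓝 x₀, ∀ G : X → ℝ, ContDiff ℝ 1 G →
      ∃ g : M → ℝ, ContMDiff 𝓘(ℝ, X) 𝓘(ℝ, ℝ) 1 g ∧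
        ∀ x ∈ U, g =ᶠ[𝓝 x] fun y => G (chartAt X x₀ y) := by
  obtain ⟨β, -, -, hβ, hβ1, hβt, -⟩ := exists_cutoff hb x₀ univ_mem
  -- The neighborhood is the interior of `{β = 1}`. It does not depend on `G`, as the test functions
  -- arise only after the ball has been chosen.
  refine ⟨_, eventually_eventually_nhds.2 hβ1, fun G hG =>
    ⟨fun y => β y * G (chartAt X x₀ y), ?_, fun x hx => ?_⟩⟩
  · refine contMDiff_of_tsupport fun x hx => ?_
    exact hβ.contMDiffAt.mul (contMDiffAt_comp_chartAt
      (hβt ((closure_mono (Function.support_mul_subset_left _ _)) hx)).2 hG)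
  · filter_upwards [hx] with y hy
    rw [hy, one_mul]

end Extension

/-! ### Comparison of the distance with the topology -/

namespace FinslerStructure

variable {X : Type*} [NormedAddCommGroup X] [NormedSpace ℝ X]
  {M : Type*} [TopologicalSpace M] [ChartedSpace X M] [IsManifold 𝓘(ℝ, X) 1 M]
  (F : FinslerStructure X M)

section Topology

/-- Around each point there is a bump function with bounded differential. -/
theorem exists_lipschitz_cutoff [RegularSpace M] {b : X → ℝ} {K : NNReal} (hb : IsUnitBump b K)
    (x₀ : M) {U : Set M} (hU : U ∈ 𝓝 x₀) : ∃ (β : M → ℝ) (C : ℝ), 0 < C ∧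
      ContMDiff 𝓘(ℝ, X) 𝓘(ℝ, ℝ) 1 β ∧ β x₀ = 1 ∧ (∀ x ∉ U, β x = 0) ∧
      ∀ x (ξ : TangentSpace 𝓘(ℝ, X) x), |mvfderiv 𝓘(ℝ, X) β x ξ| ≤ C * F.normAt x ξ := by
  have hx₀ := mem_chart_source X x₀
  obtain ⟨k, hk1, hk⟩ := F.exists_chartSeminorm_equiv x₀
  have hk0 : 0 < k := by linarith
  obtain ⟨R, hR, -⟩ := F.exists_isAdaptedBall x₀ one_pos univ_mem
  obtain ⟨β, B, L, hβ, hβ1, hβt, hB, hBL, hβB⟩ := exists_cutoff hb x₀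
    (inter_mem hU (((chartAt X x₀).continuousAt hx₀).preimage_mem_nhds
      (Metric.closedBall_mem_nhds _ hR.pos)))
  -- `k` passes from the norm of `X` to the norm at `x₀`, `1 + 1` from there to the norm at `x`; `L
  -- + 1` ensures positivity.
  refine ⟨β, (L + 1) * (k * (1 + 1)), by positivity, hβ, hβ1.self_of_nhds, fun x hx => ?_,
    fun x ξ => ?_⟩
  · by_contra h
    exact hx (hβt (subset_tsupport _ h)).1.1
  · by_cases hx : x ∈ tsupport β
    · obtain ⟨⟨-, hxR⟩, hxs⟩ := hβt hx
      have h1 : β =ᶠ[𝓝 x] fun y => B (chartAt X x₀ y) := by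
        filter_upwards [(chartAt X x₀).open_source.mem_nhds hxs] with y hy using hβB y hy
      rw [mvfderiv_apply_of_eventuallyEq_comp_chartAt hxs hB h1,
        F.normAt_eq_chartSeminorm hxs]
      set w : X := mfderiv 𝓘(ℝ, X) 𝓘(ℝ, X) (chartAt X x₀) x ξ
      have h2 := (hk w).1
      rw [inv_mul_le_iff₀ hk0] at h2
      have h3 := hR.mul_ge _ hxR w
      calc |fderiv ℝ B (chartAt X x₀ x) w| ≤ L * ‖w‖ :=
            ContinuousLinearMap.le_of_opNorm_le _ (norm_fderiv_le_of_lipschitz ℝ hBL) w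
        _ ≤ (L + 1) * (k * ((1 + 1) * F.chartSeminorm x₀ (chartAt X x₀ x) w)) := by
            have := h2.trans (mul_le_mul_of_nonneg_left h3 hk0.le)
            gcongr
            linarith
        _ = _ := by ring
    · have h1 : β =ᶠ[𝓝 x] fun _ => 0 := notMem_tsupport_iff_eventuallyEq.1 hx
      have h2 : mvfderiv 𝓘(ℝ, X) β x ξ = 0 := by
        rw [mvfderiv, h1.mfderiv_eq, mfderiv_const]; rfl
      rw [h2, abs_zero]
      have : 0 ≤ F.normAt x ξ := apply_nonneg _ _
      positivity

/-- Convergence for the Finsler distance implies convergence for the topology of the manifold. -/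
theorem tendsto_of_tendsto_dist [RegularSpace M] [ConnectedSpace M] {b : X → ℝ} {K : NNReal}
    (hb : IsUnitBump b K) {s : ℕ → M} {x : M} (hs : Tendsto (fun n => F.dist (s n) x) atTop (𝓝 0)) :
    Tendsto s atTop (𝓝 x) := by
  intro U hU
  -- `β` drops from `1` at `x` to `0` off `U` and is `C`-Lipschitz, so points off `U` are at
  -- distance at least `C⁻¹` from `x`.
  obtain ⟨β, C, hC, hβ, hβx, hβU, hβC⟩ := F.exists_lipschitz_cutoff hb x hU
  change ∀ᶠ n in atTop, s n ∈ U
  filter_upwards [hs.eventually (gt_mem_nhds (inv_pos.2 hC))] with n hn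
  by_contra hnU
  have h1 := F.enorm_sub_le_mul_edist hβ hC hβC (s n) x
  rw [hβx, hβU _ hnU, sub_zero, enorm_one, ← ENNReal.ofReal_toReal (F.edist_ne_top (s n) x),
    ← ENNReal.ofReal_mul hC.le, ENNReal.one_le_ofReal] at h1
  have h2 : F.dist (s n) x * C < 1 := by
    calc F.dist (s n) x * C < C⁻¹ * C := by gcongr
      _ = 1 := inv_mul_cancel₀ hC.ne'
  rw [dist] at h2
  linarith

end Topology

/-! ### Dual norms -/

section DualNorm

theorem dualNorm_nonneg (x : M) (Δ : TangentSpace 𝓘(ℝ, X) x →L[ℝ] ℝ) : 0 ≤ F.dualNorm x Δ :=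
  Real.sSup_nonneg (by rintro _ ⟨ξ, -, rfl⟩; exact abs_nonneg _)

theorem dualNorm_le {x : M} {Δ : TangentSpace 𝓘(ℝ, X) x →L[ℝ] ℝ} {t : ℝ} (ht : 0 ≤ t)
    (h : ∀ ξ, |Δ ξ| ≤ t * F.normAt x ξ) : F.dualNorm x Δ ≤ t :=
  Real.sSup_le (by rintro _ ⟨ξ, hξ, rfl⟩; simpa [hξ] using h ξ) ht

/-- The a priori bound `h` is needed because the real supremum of an unbounded set is `0` by
convention. -/
theorem abs_apply_le_dualNorm_mul {x : M} {Δ : TangentSpace 𝓘(ℝ, X) x →L[ℝ] ℝ} {t : ℝ}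
    (h : ∀ ξ, |Δ ξ| ≤ t * F.normAt x ξ) (ξ : TangentSpace 𝓘(ℝ, X) x) :
    |Δ ξ| ≤ F.dualNorm x Δ * F.normAt x ξ := by
  rcases (apply_nonneg (F.normAt x) ξ).eq_or_lt with h0 | h0
  · rw [F.eq_zero x ξ h0.symm]; simp
  · have hbdd : BddAbove {r | ∃ ξ : TangentSpace 𝓘(ℝ, X) x, F.normAt x ξ = 1 ∧ r = |Δ ξ|} :=
      ⟨t, by rintro _ ⟨η, hη, rfl⟩; simpa [hη] using h η⟩
    have h1 : |Δ ((F.normAt x ξ)⁻¹ • ξ)| ≤ F.dualNorm x Δ := by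
      refine le_csSup hbdd ⟨_, ?_, rfl⟩
      rw [map_smul_eq_mul, norm_inv, Real.norm_of_nonneg h0.le, inv_mul_cancel₀ h0.ne']
    rw [map_smul, smul_eq_mul, abs_mul, abs_inv, abs_of_pos h0, inv_mul_le_iff₀ h0] at h1
    linarith

variable {F}

/-- In an adapted ball, the dual norm controls the differential read in the chart. -/
theorem IsAdaptedBall.abs_apply_le {x₀ : M} {κ R : ℝ} (h : F.IsAdaptedBall x₀ κ R)
    {y : X} (hy : y ∈ Metric.closedBall (chartAt X x₀ x₀) R)
    {Δ : TangentSpace 𝓘(ℝ, X) ((chartAt X x₀).symm y) →L[ℝ] ℝ} {l : X →L[ℝ] ℝ}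
    (hΔ : ∀ w : X, Δ (mfderiv 𝓘(ℝ, X) 𝓘(ℝ, X) (chartAt X x₀).symm y w) = l w) (w : X) :
    |l w| ≤ F.dualNorm _ Δ * ((1 + κ) * F.chartSeminorm x₀ (chartAt X x₀ x₀) w) := by
  obtain ⟨k, hk1, hk⟩ := F.exists_chartSeminorm_equiv x₀
  have hk0 : 0 < k := by linarith
  have h1 : ∀ ξ, |Δ ξ| ≤ (‖l‖ * (k * (1 + κ))) * F.normAt _ ξ := by
    intro ξ
    obtain ⟨w, rfl⟩ := exists_mfderiv_symm_eq (h.subset_target hy) ξ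
    rw [hΔ, ← chartSeminorm_apply]
    have h2 := (hk w).1
    rw [inv_mul_le_iff₀ hk0] at h2
    have h3 := mul_le_mul_of_nonneg_left (h.mul_ge _ hy w) hk0.le
    calc |l w| ≤ ‖l‖ * ‖w‖ := l.le_opNorm w
      _ ≤ ‖l‖ * (k * ((1 + κ) * F.chartSeminorm x₀ y w)) := by gcongr; exact h2.trans h3
      _ = _ := by ring
  rw [← hΔ]
  refine (F.abs_apply_le_dualNorm_mul h1 _).trans ?_
  rw [← chartSeminorm_apply]
  exact mul_le_mul_of_nonneg_left (h.le_mul _ hy w) (F.dualNorm_nonneg _ _)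

theorem IsAdaptedBall.dualNorm_le {x₀ : M} {κ R : ℝ} (h : F.IsAdaptedBall x₀ κ R) (hκ : 0 ≤ κ)
    {y : X} (hy : y ∈ Metric.closedBall (chartAt X x₀ x₀) R)
    {Δ : TangentSpace 𝓘(ℝ, X) ((chartAt X x₀).symm y) →L[ℝ] ℝ} {l : X →L[ℝ] ℝ}
    (hΔ : ∀ w : X, Δ (mfderiv 𝓘(ℝ, X) 𝓘(ℝ, X) (chartAt X x₀).symm y w) = l w) {t : ℝ}
    (ht : 0 ≤ t) (hl : ∀ w, |l w| ≤ t * F.chartSeminorm x₀ (chartAt X x₀ x₀) w) :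
    F.dualNorm _ Δ ≤ t * (1 + κ) := by
  refine F.dualNorm_le (mul_nonneg ht (by linarith)) fun ξ => ?_
  obtain ⟨w, rfl⟩ := exists_mfderiv_symm_eq (h.subset_target hy) ξ
  rw [hΔ, ← chartSeminorm_apply, mul_assoc]
  exact (hl w).trans (mul_le_mul_of_nonneg_left (h.mul_ge _ hy w) ht)

end DualNorm

end FinslerStructure

/-! ### Subdifferentials read in charts -/

section Subdifferential

variable {X : Type*} [NormedAddCommGroup X] [NormedSpace ℝ X]
  {M : Type*} [TopologicalSpace M] [ChartedSpace X M]

/-- The fuzzy sum rule concerns minima of two lower semicontinuous functions; this translates its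
output for `-u` back to `u`. -/
theorem neg_mem_superdifferential {v : M → ℝ} {x : M} {Δ : TangentSpace 𝓘(ℝ, X) x →L[ℝ] ℝ}
    (h : Δ ∈ subdifferential X (fun y => -v y) x) : -Δ ∈ superdifferential X v x := by
  obtain ⟨g, hg, hmin, rfl⟩ := h
  refine ⟨-g, hg.neg, ?_, mvfderiv_neg⟩
  filter_upwards [hmin] with y hy
  simp only [Pi.neg_apply]
  linarith

variable [IsManifold 𝓘(ℝ, X) 1 M]

theorem mvfderiv_apply_mfderiv_symm {x₀ : M} {y : X} (hy : y ∈ (chartAt X x₀).target)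
    {G : X → ℝ} (hG : ContDiff ℝ 1 G) {g : M → ℝ}
    (hg : g =ᶠ[𝓝 ((chartAt X x₀).symm y)] fun y => G (chartAt X x₀ y)) (w : X) :
    mvfderiv 𝓘(ℝ, X) g ((chartAt X x₀).symm y)
      (mfderiv 𝓘(ℝ, X) 𝓘(ℝ, X) (chartAt X x₀).symm y w) = fderiv ℝ G y w := by
  rw [mvfderiv_apply_of_eventuallyEq_comp_chartAt ((chartAt X x₀).map_target hy) hG hg]
  have h1 := DFunLike.congr_fun
    ((mdifferentiable_chart (I := 𝓘(ℝ, X)) x₀).comp_symm_deriv hy) w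
  change mfderiv 𝓘(ℝ, X) 𝓘(ℝ, X) (chartAt X x₀) ((chartAt X x₀).symm y)
    (mfderiv 𝓘(ℝ, X) 𝓘(ℝ, X) (chartAt X x₀).symm y w) = w at h1
  rw [h1, (chartAt X x₀).right_inv hy]

/-- A local test function in the chart at `x₀` gives a subdifferential. -/
theorem exists_mem_subdifferential {x₀ : M} {y : X} (hy : y ∈ (chartAt X x₀).target)
    {G : X → ℝ} (hG : ContDiff ℝ 1 G) {g : M → ℝ} (hgc : ContMDiff 𝓘(ℝ, X) 𝓘(ℝ, ℝ) 1 g)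
    (hg : g =ᶠ[𝓝 ((chartAt X x₀).symm y)] fun y => G (chartAt X x₀ y)) {v : M → ℝ}
    (hmin : IsLocalMin (fun y' => v ((chartAt X x₀).symm y') - G y') y) :
    ∃ Δ ∈ subdifferential X v ((chartAt X x₀).symm y),
      ∀ w : X, Δ (mfderiv 𝓘(ℝ, X) 𝓘(ℝ, X) (chartAt X x₀).symm y w) = fderiv ℝ G y w := by
  refine ⟨_, ⟨g, hgc, ?_, rfl⟩, mvfderiv_apply_mfderiv_symm hy hG hg⟩
  set e := chartAt X x₀
  have hs := e.map_target hy
  have h1 : Tendsto e (𝓝 (e.symm y)) (𝓝 y) := by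
    have := e.continuousAt hs
    rwa [ContinuousAt, e.right_inv hy] at this
  filter_upwards [h1.eventually hmin, hg, e.open_source.mem_nhds hs] with x hx hgx hxs
  have h2 : g (e.symm y) = G y := by rw [hg.self_of_nhds]; exact congrArg G (e.right_inv hy)
  rw [hgx, h2]
  rwa [e.left_inv hxs] at hx

end Subdifferential

/-! ### Nearby differentials at an Ekeland point -/

namespace FinslerStructure

variable {X : Type*} [NormedAddCommGroup X] [NormedSpace ℝ X]
  {M : Type*} [TopologicalSpace M] [ChartedSpace X M] [IsManifold 𝓘(ℝ, X) 1 M]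
  {F : FinslerStructure X M}

/-- A function that is Lipschitz for the Finsler distance is Lipschitz in an adapted ball. -/
theorem IsAdaptedBall.abs_sub_le {x₀ : M} {κ R : ℝ} (h : F.IsAdaptedBall x₀ κ R) (hκ : 0 ≤ κ)
    (hκ1 : κ ≤ 1) {A : Set M}
    (hA : ∀ y ∈ Metric.closedBall (chartAt X x₀ x₀) R, (chartAt X x₀).symm y ∈ A)
    {f : M → ℝ} {L : ℝ} (hL : 0 ≤ L) (hf : ∀ y ∈ A, ∀ z ∈ A, |f y - f z| ≤ L * F.dist y z)
    {y z : X} (hy : y ∈ Metric.closedBall (chartAt X x₀ x₀) R)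
    (hz : z ∈ Metric.closedBall (chartAt X x₀ x₀) R) :
    |f ((chartAt X x₀).symm y) - f ((chartAt X x₀).symm z)| ≤
      2 * L * F.chartSeminorm x₀ (chartAt X x₀ x₀) (y - z) := by
  have h1 := hf _ (hA z hz) _ (hA y hy)
  have h2 := h.dist_le hκ hz hy
  have h3 : 0 ≤ F.chartSeminorm x₀ (chartAt X x₀ x₀) (y - z) := apply_nonneg _ _
  rw [abs_sub_comm]
  calc _ ≤ _ := h1
    _ ≤ L * ((1 + κ) * F.chartSeminorm x₀ (chartAt X x₀ x₀) (y - z)) := by gcongr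
    _ ≤ L * ((1 + 1) * F.chartSeminorm x₀ (chartAt X x₀ x₀) (y - z)) := by gcongr
    _ = _ := by ring

/-- At an Ekeland point of `v - u` there are nearby points carrying a superdifferential of `u`
and a subdifferential of `v` with almost equal dual norms. -/
theorem exists_close_differentials [CompleteSpace X] [RegularSpace M] {b : X → ℝ}
    {K : NNReal} (hb : IsUnitBump b K) {u v : M → ℝ} (hu : UpperSemicontinuous u)
    (hv : LowerSemicontinuous v) {B : ℝ} (huB : ∀ x, |u x| ≤ B) (hvB : ∀ x, |v x| ≤ B) {x₀ : M}
    (hlip : F.IsLipschitzNear u x₀ ∨ F.IsLipschitzNear v x₀) {ε : ℝ} (hε : 0 < ε)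
    (hmin : ∀ y, v x₀ - u x₀ ≤ v y - u y + ε * F.dist x₀ y) :
    ∃ T, 0 ≤ T ∧ ∀ r > 0, ∃ x₁ x₂ : M, ∃ Δ₁ ∈ subdifferential X v x₁,
      ∃ Δ₂ ∈ superdifferential X u x₂, v x₁ - u x₂ ≤ v x₀ - u x₀ + r ∧ F.dist x₁ x₂ ≤ r ∧
      F.dualNorm x₁ Δ₁ ≤ T ∧ F.dualNorm x₂ Δ₂ ≤ T ∧
      |F.dualNorm x₁ Δ₁ - F.dualNorm x₂ Δ₂| ≤ 10 * ε + r := by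
  obtain ⟨A, hA, L, hL, hALip⟩ : ∃ A ∈ 𝓝 x₀, ∃ L : ℝ, 0 ≤ L ∧
      ((∀ y ∈ A, ∀ z ∈ A, |v y - v z| ≤ L * F.dist y z) ∨
        ∀ y ∈ A, ∀ z ∈ A, |(-u y) - (-u z)| ≤ L * F.dist y z) := by
    rcases hlip with ⟨A, hA, L, hL, h⟩ | ⟨A, hA, L, hL, h⟩
    · refine ⟨A, hA, L, hL, Or.inr fun y hy z hz => ?_⟩
      rw [neg_sub_neg, abs_sub_comm]
      exact h y hy z hz
    · exact ⟨A, hA, L, hL, Or.inl h⟩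
  obtain ⟨U, hU, hext⟩ := exists_contMDiff_extension hb x₀
  obtain ⟨k, hk1, hk⟩ := F.exists_chartSeminorm_equiv x₀
  have hk0 : 0 < k := by linarith
  set e := chartAt X x₀ with he
  set p := F.chartSeminorm x₀ (e x₀) with hp
  have hx₀ : x₀ ∈ e.source := mem_chart_source X x₀
  -- The test function of the Lipschitz member has derivative at most `2L p`; the other differs by
  -- at most `5ε p`. Passing to dual norms costs `1 + κ ≤ 2`, whence the bound `2 * T₀`, independent
  -- of `r`.
  set T₀ : ℝ := 2 * L + 5 * ε with hT₀
  have hT₀0 : 0 < T₀ := by positivity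
  refine ⟨2 * T₀, by positivity, fun r hr => ?_⟩
  -- Comparing the dual norms at the two points costs `(1 + κ)² - 1 ≤ 3κ` times a dual norm, itself
  -- at most `2T₀`.
  obtain ⟨κ, hκ0, hκ1, hκT⟩ : ∃ κ : ℝ, 0 < κ ∧ κ ≤ 1 ∧ 3 * κ * (2 * T₀) ≤ r := by
    refine ⟨min 1 (r / (6 * T₀)), by positivity, min_le_left _ _, ?_⟩
    have := min_le_right 1 (r / (6 * T₀))
    rw [le_div_iff₀ (by positivity)] at this
    linarith
  obtain ⟨R, hR, hRAU⟩ := F.exists_isAdaptedBall x₀ hκ0 (inter_mem hA hU)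
  have hRA : ∀ y ∈ Metric.closedBall (e x₀) R, e.symm y ∈ A := fun y hy => (hRAU y hy).1
  obtain ⟨δ, hδ, hδε, hδr, hδR, hδk⟩ : ∃ δ : ℝ, 0 < δ ∧ δ ≤ ε ∧ δ ≤ r ∧ δ ≤ R ∧
      4 * k * δ ≤ r := by
    refine ⟨min (min ε r) (min R (r / (4 * k))), ?_, (min_le_left _ _).trans (min_le_left _ _),
      (min_le_left _ _).trans (min_le_right _ _), (min_le_right _ _).trans (min_le_left _ _), ?_⟩
    · have := hR.pos
      positivity
    · have : min (min ε r) (min R (r / (4 * k))) ≤ r / (4 * k) :=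
        (min_le_right _ _).trans (min_le_right _ _)
      rw [le_div_iff₀ (by positivity)] at this
      linarith
  have hcont : ContinuousOn e.symm (Metric.closedBall (e x₀) R) :=
    e.continuousOn_symm.mono hR.subset_target
  have hflsc : LowerSemicontinuousOn (fun y => v (e.symm y)) (Metric.closedBall (e x₀) R) :=
    (hv.lowerSemicontinuousOn univ).comp_of_mapsTo hcont (mapsTo_univ _ _)
  have hglsc : LowerSemicontinuousOn (fun y => -u (e.symm y)) (Metric.closedBall (e x₀) R) := by
    have : LowerSemicontinuous fun y => -u y := fun x c hc => by
      filter_upwards [hu x (-c) (by linarith)] with y hy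
      linarith
    exact (this.lowerSemicontinuousOn univ).comp_of_mapsTo hcont (mapsTo_univ _ _)
  have hlip1 : ∀ {f : M → ℝ}, (∀ y ∈ A, ∀ z ∈ A, |f y - f z| ≤ L * F.dist y z) →
      ∀ y ∈ Metric.closedBall (e x₀) R, ∀ z ∈ Metric.closedBall (e x₀) R,
      |f (e.symm y) - f (e.symm z)| ≤ 2 * L * p (y - z) := fun hf y hy z hz =>
    hR.abs_sub_le hκ0.le hκ1 hRA hL hf hy hz
  have hlip2 : ∀ {f : M → ℝ}, (∀ y ∈ A, ∀ z ∈ A, |f y - f z| ≤ L * F.dist y z) →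
      ∀ y ∈ Metric.closedBall (e x₀) R, ∀ z ∈ Metric.closedBall (e x₀) R,
      |f (e.symm y) - f (e.symm z)| ≤ 2 * L * k * ‖y - z‖ := fun hf y hy z hz => by
    rw [mul_assoc]
    exact (hlip1 hf y hy z hz).trans (by gcongr; exact (hk _).2)
  have hz₀ : e x₀ ∈ Metric.closedBall (e x₀) R := Metric.mem_closedBall_self hR.pos.le
  obtain ⟨x, hx, y, hy, G₁, G₂, hG₁, hG₂, hm₁, hm₂, hval, hder⟩ :=
    hb.fuzzy_sum_rule p hk1 hk hR.pos hflsc hglsc (fun y _ => hvB _)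
      (fun y _ => (abs_neg _).trans_le (huB _)) (L := 2 * L * k) (by positivity)
      (hALip.imp (fun h => hlip2 h) (fun h => hlip2 h)) (ε := 2 * ε) (by positivity)
      (fun x hx => by
        have h1 := hmin (e.symm x)
        have h2 := hR.dist_le hκ0.le hz₀ hx
        rw [← he, e.left_inv hx₀, ← hp] at h2
        have h3 : 0 ≤ p (x - e x₀) := apply_nonneg _ _
        have h4 : (1 + κ) * p (x - e x₀) ≤ 2 * p (x - e x₀) := by gcongr; linarith
        have h5 := mul_le_mul_of_nonneg_left (h2.trans h4) hε.le
        rw [e.left_inv hx₀]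
        linarith) hδ
  rw [e.left_inv hx₀] at hval
  have hsub : Metric.ball (e x₀) δ ⊆ Metric.closedBall (e x₀) R :=
    Metric.ball_subset_closedBall.trans (Metric.closedBall_subset_closedBall hδR)
  have hxR := hsub hx
  have hyR := hsub hy
  -- The sum rule was applied with `2ε`, so its error is `4ε + δ`.
  have hder' : ∀ w, |fderiv ℝ G₁ x w + fderiv ℝ G₂ y w| ≤ 5 * ε * p w := fun w =>
    (hder w).trans (by
      have : 0 ≤ p w := apply_nonneg _ _
      gcongr
      linarith)
  obtain ⟨g₁, hg₁, hgG₁⟩ := hext G₁ hG₁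
  obtain ⟨g₂, hg₂, hgG₂⟩ := hext G₂ hG₂
  obtain ⟨Δ₁, hΔ₁, hl₁⟩ := exists_mem_subdifferential (hR.subset_target hxR) hG₁ hg₁
    (hgG₁ _ (hRAU x hxR).2) hm₁
  obtain ⟨Δ₂, hΔ₂, hl₂⟩ := exists_mem_subdifferential (v := fun y => -u y)
    (hR.subset_target hyR) hG₂ hg₂ (hgG₂ _ (hRAU y hyR).2) hm₂
  have hl₂' : ∀ w : X, (-Δ₂) (mfderiv 𝓘(ℝ, X) 𝓘(ℝ, X) e.symm y w) = (-fderiv ℝ G₂ y) w :=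
    fun w => by rw [neg_apply, neg_apply, hl₂]
  have habs : ∀ w, |fderiv ℝ G₁ x w| ≤ |(-fderiv ℝ G₂ y) w| + 5 * ε * p w ∧
      |(-fderiv ℝ G₂ y) w| ≤ |fderiv ℝ G₁ x w| + 5 * ε * p w := by
    intro w
    rw [neg_apply, abs_neg]
    have h1 := abs_sub_abs_le_abs_sub (fderiv ℝ G₁ x w) (-fderiv ℝ G₂ y w)
    have h2 := abs_sub_abs_le_abs_sub (fderiv ℝ G₂ y w) (-fderiv ℝ G₁ x w)
    rw [abs_neg, sub_neg_eq_add] at h1 h2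
    rw [add_comm] at h2
    have h3 := hder' w
    constructor <;> linarith
  have hnhds : ∀ a ∈ Metric.ball (e x₀) δ, Metric.closedBall (e x₀) R ∈ 𝓝 a := fun a ha =>
    mem_of_superset (Metric.isOpen_ball.mem_nhds ha) hsub
  have hT : ∀ w, |fderiv ℝ G₁ x w| ≤ T₀ * p w ∧ |(-fderiv ℝ G₂ y) w| ≤ T₀ * p w := by
    intro w
    have h0 : 0 ≤ 5 * ε * p w := by positivity
    obtain ⟨h1, h2⟩ := habs w
    rw [hT₀, add_mul]
    rcases hALip with h | h
    · have h3 := abs_fderiv_le_of_isLocalMin_sub (p := p) (hG₁.differentiable one_ne_zero x) hm₁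
        (by filter_upwards [hnhds x hx] with x' hx' using hlip1 h x' hx' x hxR) w
      constructor <;> linarith
    · have h3 := abs_fderiv_le_of_isLocalMin_sub (p := p) (hG₂.differentiable one_ne_zero y) hm₂
        (by filter_upwards [hnhds y hy] with y' hy' using hlip1 h y' hy' y hyR) w
      rw [← abs_neg, ← neg_apply] at h3
      constructor <;> linarith
  set t₁ := F.dualNorm (e.symm x) Δ₁
  set t₂ := F.dualNorm (e.symm y) (-Δ₂)
  have ht₁0 : 0 ≤ t₁ := F.dualNorm_nonneg _ _
  have ht₂0 : 0 ≤ t₂ := F.dualNorm_nonneg _ _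
  have hT2 : T₀ * (1 + κ) ≤ 2 * T₀ := by nlinarith
  have ht₁T : t₁ ≤ 2 * T₀ :=
    (hR.dualNorm_le hκ0.le hxR hl₁ hT₀0.le fun w => (hT w).1).trans hT2
  have ht₂T : t₂ ≤ 2 * T₀ :=
    (hR.dualNorm_le hκ0.le hyR hl₂' hT₀0.le fun w => (hT w).2).trans hT2
  have ht₁ : t₁ ≤ (t₂ * (1 + κ) + 5 * ε) * (1 + κ) := by
    refine hR.dualNorm_le hκ0.le hxR hl₁ (by positivity) fun w => (habs w).1.trans ?_
    have := hR.abs_apply_le hyR hl₂' w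
    linarith
  have ht₂ : t₂ ≤ (t₁ * (1 + κ) + 5 * ε) * (1 + κ) := by
    refine hR.dualNorm_le hκ0.le hyR hl₂' (by positivity) fun w => (habs w).2.trans ?_
    have := hR.abs_apply_le hxR hl₁ w
    linarith
  have hgap : ∀ s t : ℝ, 0 ≤ t → t ≤ 2 * T₀ → s ≤ (t * (1 + κ) + 5 * ε) * (1 + κ) →
      s - t ≤ 10 * ε + r := by
    intro s t h0 h1 h2
    have h3 : t * κ ≤ κ * (2 * T₀) := by rw [mul_comm]; gcongr
    have h4 : t * κ * κ ≤ t * κ := mul_le_of_le_one_right (by positivity) hκ1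
    have h5 : ε * κ ≤ ε := mul_le_of_le_one_right hε.le hκ1
    nlinarith
  refine ⟨e.symm x, e.symm y, Δ₁, hΔ₁, -Δ₂, neg_mem_superdifferential hΔ₂, by linarith, ?_, ht₁T,
    ht₂T, abs_le.2 ⟨?_, hgap _ _ ht₂0 ht₂T ht₁⟩⟩
  · have h1 := hR.dist_le hκ0.le hxR hyR
    rw [← he, ← hp] at h1
    have h2 : ‖y - x‖ ≤ 2 * δ := by
      have h3 := norm_sub_le (y - e x₀) (x - e x₀)
      rw [sub_sub_sub_cancel_right] at h3
      linarith [mem_ball_iff_norm.1 hx, mem_ball_iff_norm.1 hy]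
    calc _ ≤ (1 + κ) * p (y - x) := h1
      _ ≤ (1 + 1) * (k * (2 * δ)) := by
          gcongr
          exact (hk _).2.trans (by gcongr)
      _ = 4 * k * δ := by ring
      _ ≤ r := hδk
  · linarith [hgap _ _ ht₁0 ht₁T ht₂]

end FinslerStructure

end FinslerHJ

/-! ### The comparison principle -/

theorem mainTheorem2 {X : Type*} [NormedAddCommGroup X] [NormedSpace ℝ X] [CompleteSpace X]
    (hX : FinslerHJ.HasLipschitzBump X)
    {M : Type*} [TopologicalSpace M] [T2Space M] [ParacompactSpace M] [ConnectedSpace M]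
    [ChartedSpace X M] [IsManifold 𝓘(ℝ, X) 1 M]
    (F : FinslerHJ.FinslerStructure X M) (hF : F.IsComplete)
    (H : M → ℝ → ℝ) (hH : Continuous (Function.uncurry H)) (hA : F.ConditionA H)
    (u v : M → ℝ)
    (hu : F.IsViscositySubsolution H u) (hv : F.IsViscositySupersolution H v)
    (hu_bdd : ∃ B : ℝ, ∀ x, |u x| ≤ B) (hv_bdd : ∃ B : ℝ, ∀ x, |v x| ≤ B)
    (hLip : ∀ x, F.IsLipschitzNear u x ∨ F.IsLipschitzNear v x) :
    0 ≤ ⨅ x, (v x - u x) := by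
  obtain ⟨b, K, hb⟩ := hX.exists_isUnitBump
  obtain ⟨C, ω, hC, hω, hω0, hHA⟩ := hA
  obtain ⟨B, huB, hvB⟩ : ∃ B : ℝ, (∀ x, |u x| ≤ B) ∧ ∀ x, |v x| ≤ B := by
    obtain ⟨B₁, h1⟩ := hu_bdd
    obtain ⟨B₂, h2⟩ := hv_bdd
    exact ⟨max B₁ B₂, fun x => (h1 x).trans (le_max_left _ _),
      fun x => (h2 x).trans (le_max_right _ _)⟩
  have hlow : ∀ x, -(2 * B) ≤ v x - u x := fun x => by
    linarith [(abs_le.1 (huB x)).2, (abs_le.1 (hvB x)).1]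
  by_contra! hneg
  set m := ⨅ x, (v x - u x) with hm
  have hθ : 0 < -m / 8 := by linarith
  obtain ⟨ρ, hρ, hωρ⟩ : ∃ ρ > 0, ∀ s t : ℝ, |s| < ρ → |t| < ρ → ω (s, t) < -m / 8 := by
    obtain ⟨ρ, hρ, h⟩ := Metric.mem_nhds_iff.1
      ((hω.tendsto (0, 0)).eventually (gt_mem_nhds (hω0.trans_lt hθ)))
    exact ⟨ρ, hρ, fun s t hs ht => h (by simpa [Prod.dist_eq] using ⟨hs, ht⟩)⟩
  have hlsc : ∀ (s : ℕ → M) (x : M), Tendsto (fun n => F.dist (s n) x) atTop (𝓝 0) →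
      ∀ c < v x - u x, ∀ᶠ n in atTop, c < v (s n) - u (s n) := by
    intro s x hs c hc
    have h1 := F.tendsto_of_tendsto_dist hb hs
    filter_upwards [h1.eventually (hv.1 x (v x - (v x - u x - c) / 2) (by linarith)),
      h1.eventually (hu.1 x (u x + (v x - u x - c) / 2) (by linarith))] with n h2 h3
    linarith
  obtain ⟨a, ha⟩ : ∃ a, v a - u a < m + -m / 8 := exists_lt_of_ciInf_lt (by linarith)
  -- With `ε = ρ / 20` the gap `10ε + r` between dual norms is `ρ / 2 + r`, below `ρ` once `r < ρ /
  -- 2`.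
  obtain ⟨x₀, hx₀a, hx₀⟩ := FinslerHJ.exists_ekeland F.dist F.dist_nonneg F.dist_self F.dist_comm
    F.dist_triangle hF hlsc ⟨_, hlow⟩ (ε := ρ / 20) (by positivity) a
  obtain ⟨T, hT, hclose⟩ := FinslerHJ.FinslerStructure.exists_close_differentials hb hu.1 hv.1
    huB hvB (hLip x₀) (ε := ρ / 20) (by positivity) hx₀
  obtain ⟨r, hr, hrθ, hrρ, hrC⟩ : ∃ r : ℝ, 0 < r ∧ r ≤ -m / 8 ∧ r < ρ / 2 ∧
      C * T * r ≤ -m / 8 := by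
    refine ⟨min (min (-m / 8) (ρ / 4)) (-m / 8 / (C * T + 1)), by positivity,
      (min_le_left _ _).trans (min_le_left _ _),
      ((min_le_left _ _).trans (min_le_right _ _)).trans_lt (by linarith), ?_⟩
    set r := min (min (-m / 8) (ρ / 4)) (-m / 8 / (C * T + 1))
    have h1 : r ≤ -m / 8 / (C * T + 1) := min_le_right _ _
    have h2 : 0 < r := by positivity
    rw [le_div_iff₀ (by positivity)] at h1
    linarith
  obtain ⟨x₁, x₂, Δ₁, hΔ₁, Δ₂, hΔ₂, hval, hdist, ht₁, ht₂, hgap⟩ := hclose r hr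
  have h1 := hv.2 x₁ Δ₁ hΔ₁
  have h2 := hu.2 x₂ Δ₂ hΔ₂
  have h3 := (abs_le.1 (hHA x₁ x₂ (F.dualNorm x₁ Δ₁) (F.dualNorm x₂ Δ₂))).2
  have hd0 := F.dist_nonneg x₁ x₂
  have h4 := hωρ (F.dist x₁ x₂) (F.dualNorm x₁ Δ₁ - F.dualNorm x₂ Δ₂)
    (by rw [abs_of_nonneg hd0]; linarith) (by linarith)
  have h5 : C * max |F.dualNorm x₁ Δ₁| |F.dualNorm x₂ Δ₂| * F.dist x₁ x₂ ≤ C * T * r := by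
    rw [abs_of_nonneg (F.dualNorm_nonneg _ _), abs_of_nonneg (F.dualNorm_nonneg _ _)]
    gcongr
    exact max_le ht₁ ht₂
  -- With `θ = -m / 8`: `v x₁ - u x₂ < m + 2θ = -6θ`, while the two values of `H` differ by less
  -- than `2θ`; the viscosity inequalities would make the total nonnegative.
  linarith
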